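/- Fix a set $\Sigma$ of selectors. A $\Sigma$-typed alphabet is a set of symbols $a$, each with a finite set $\mathrm{type}(a)\subseteq\Sigma$. A hypergraph $H$ over such an alphabet has a finite set $V_H$ of nodes, a finite set $E_H$ of hyperedges, for each $e\in E_H$ a label $\mathrm{lab}_H(e)$ and an attachment function $\mathrm{att}_H(e):\mathrm{type}(\mathrm{lab}_H(e))\to V_H$, and a function $\mathrm{ext}_H:\mathrm{type}(H)\to V_H$ with $\mathrm{type}(H)\subseteq\Sigma$. Its size is $|H|=|V_H|+|E_H|$. Hypergraphs are considered up to isomorphism. If $\mathrm{type}(\mathrm{lab}_K(e))=\mathrm{type}(H)$, then $K[e/H]$ denotes the hypergraph obtained from $K$ by removing the hyperedge $e$, adding a disjoint copy of $H$, and gluing $\mathrm{att}_K(e)(\sigma)$ with $\mathrm{ext}_H(\sigma)$ for each $\sigma\in\mathrm{type}(H)$; its external nodes are those of $K$. A hypergraph transformation system (ht-system) $\mathcal G=\langle N,T,P,S\rangle$ consists of finite typed alphabets $N,T$ (contained in a common typed alphabet), a finite set $P$ of rules $H\to H'$, where $H,H'$ are hypergraphs over $N\cup T$ with $\mathrm{type}(H)=\mathrm{type}(H')$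 and $\mathrm{ext}_H,\mathrm{ext}_{H'}$ injective, and a hypergraph $S$ over $N\cup T$ with $\mathrm{ext}_S$ injective. We write $G\Rightarrow G'$ if $G=K[e/H]$ and $G'=K[e/H']$ for some rule $(H\to H')\in P$, some hypergraph $K$ and some $e\in E_K$ with $\mathrm{att}_K(e)$ injective (the label of $e$ may be any symbol of type $\mathrm{type}(H)$, not necessarily from $N\cup T$). The language $L(\mathcal G)$ is the set of hypergraphs $H$ over $T$ such that $S\Rightarrow^* H$. The system is linear-time if there is $c\in\mathbb N$ such that each $H\in L(\mathcal G)$ has a derivation $S\Rightarrow^* H$ with at most $c\cdot|H|$ steps. Formulae of $\mathrm{MILL}1$ (first-order multiplicative intuitionistic linear logic) are built from atoms $p(x_1,\dots,x_n)$, where the $x_i$ are variables from a countably infinite set and there are countably infinitely many predicate symbols of each arity, by $\otimes,\multimap,\exists,\forall$ (no constants, no function symbols); sequents $\Gamma\vdash B$ have a finite multiset of formulae on the left. Derivability is given by the axioms $A\vdash A$ and the usual left and right rules for $\otimes,\multimap,\exists,\forall$. A hypergraph $\mathrm{MILL}1$ grammar $\mathcal G'=\langle T,F,X,\triangleright\rangle$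 consists of a finite typed alphabet $T$, a set $X\subseteq\Sigma$, a formula $F$ with free variables in $X$, and a finite relation $\triangleright$ between $T\cup\{\bullet\}$ and formulae such that $a\triangleright A$ implies $\mathrm{FVar}(A)\subseteq\mathrm{type}(a)$ for $a\in T$, and $\bullet\triangleright A$ implies $\mathrm{FVar}(A)\subseteq\{x_\bullet\}$ (selectors and nodes are used as variables; $\bullet$ is a fixed symbol and $x_\bullet$ a fixed variable). A hypergraph $H$ over $T$ is in $L(\mathcal G')$ if and only if $\mathrm{type}(H)=X$ and there are formulae $h_E(e)$ for $e\in E_H$ and $h_V(v)$ for $v\in V_H$ with $\mathrm{lab}_H(e)\triangleright h_E(e)$ and $\bullet\triangleright h_V(v)$ such that the sequent $$\{h_E(e)[\mathrm{att}_H(e)]\mid e\in E_H\},\ \{h_V(v)[v/x_\bullet]\mid v\in V_H\}\ \vdash\ F[\mathrm{ext}_H]$$ is derivable in $\mathrm{MILL}1$, where distinct nodes are distinct variables. **Theorem.** For every linear-time ht-system $\mathcal G=\langle N,T,P,S\rangle$ there is a hypergraph $\mathrm{MILL}1$ grammar $\mathcal G'$ with the same terminal alphabet $T$ such that $L(\mathcal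 G')=L(\mathcal G)$. -/

import Mathlib

universe u v

namespace HG

/-! ## Typed alphabets and hypergraphs -/

/-- A typed alphabet over the set `Sel` of selectors: symbols together with a function that
assigns to each symbol a finite set of selectors. -/
structure TypedAlphabet (Sel : Type u) where
  Symbol : Type v
  type : Symbol → Set Sel
  finite_type : ∀ a, (type a).Finite

variable {Sel : Type u}

/-- The alphabet `A` together with one new symbol `none` of the finite type `X`. -/
def TypedAlphabet.addSymbol (A : TypedAlphabet.{u, v} Sel) (X : Set Sel) (hX : X.Finite) :
    TypedAlphabet.{u, v} Sel where
  Symbol := Option A.Symbol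
  type := fun o => match o with
    | none => X
    | some a => A.type a
  finite_type := by
    rintro (_ | a)
    · exact hX
    · exact A.finite_type a

/-- Hypergraphs whose hyperedges are labelled by symbols of `A`. The attachment function of a
hyperedge is defined on the type of its label; the function `ext`, which marks the external
nodes, is defined on a set `type` of selectors. Neither is assumed to be injective. -/
structure Hypergraph (A : TypedAlphabet.{u, v} Sel) where
  V : Type
  E : Type
  finite_V : Finite V
  finite_E : Finite E
  lab : E → A.Symbol
  att : (e : E) → A.type (lab e) → V
  type : Set Sel
  ext : type → V

attribute [instance] Hypergraph.finite_V Hypergraph.finite_E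

namespace Hypergraph

variable {A : TypedAlphabet.{u, v} Sel}

/-- The size of a hypergraph: the number of its nodes and hyperedges. -/
noncomputable def size (H : Hypergraph A) : ℕ := Nat.card H.V + Nat.card H.E

/-- `H` is a hypergraph over the set `D` of symbols: all its labels are in `D`. -/
def Over (H : Hypergraph A) (D : Set A.Symbol) : Prop := ∀ e, H.lab e ∈ D

/-- Isomorphism of hypergraphs. -/
def Iso (G H : Hypergraph A) : Prop :=
  G.type = H.type ∧ ∃ (f : G.V ≃ H.V) (g : G.E ≃ H.E),
    (∀ e, H.lab (g e) = G.lab e) ∧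
    (∀ e σ (h : σ ∈ A.type (G.lab e)) (h' : σ ∈ A.type (H.lab (g e))),
      H.att (g e) ⟨σ, h'⟩ = f (G.att e ⟨σ, h⟩)) ∧
    (∀ σ (h : σ ∈ G.type) (h' : σ ∈ H.type), H.ext ⟨σ, h'⟩ = f (G.ext ⟨σ, h⟩))

/-- The pairs `(att_H(e)(σ), ext_K(σ))` of nodes of the disjoint union of `H` and `K` that are
glued together when the hyperedge `e` of `H` is replaced by `K`. -/
def GlueRel (H : Hypergraph A) (e : H.E) (K : Hypergraph A) (h : A.type (H.lab e) = K.type) :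
    H.V ⊕ K.V → H.V ⊕ K.V → Prop :=
  fun x y => ∃ σ : A.type (H.lab e),
    x = Sum.inl (H.att e σ) ∧ y = Sum.inr (K.ext ⟨σ.1, h ▸ σ.2⟩)

/-- Hyperedge replacement `H[e/K]`: remove `e` from `H`, add a disjoint copy of `K`, and take the
quotient of the set of nodes by the equivalence relation generated by `GlueRel`. -/
def replace (H : Hypergraph A) (e : H.E) (K : Hypergraph A) (h : A.type (H.lab e) = K.type) :
    Hypergraph A where
  V := Quot (GlueRel H e K h)
  E := {e' : H.E // e' ≠ e} ⊕ K.E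
  finite_V := inferInstance
  finite_E := inferInstance
  lab := Sum.elim (fun e' => H.lab e'.1) K.lab
  att := fun x => match x with
    | Sum.inl e' => fun σ => Quot.mk _ (Sum.inl (H.att e'.1 σ))
    | Sum.inr e' => fun σ => Quot.mk _ (Sum.inr (K.att e' σ))
  type := H.type
  ext := fun σ => Quot.mk _ (Sum.inl (H.ext σ))

/-- A hypergraph over `A` seen as a hypergraph over `A` with one more symbol. -/
def lift (H : Hypergraph A) (X : Set Sel) (hX : X.Finite) : Hypergraph (A.addSymbol X hX) where
  V := H.V
  E := H.E
  finite_V := H.finite_V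
  finite_E := H.finite_E
  lab := fun e => some (H.lab e)
  att := H.att
  type := H.type
  ext := H.ext

theorem finite_type_of_injective (H : Hypergraph A) (h : Function.Injective H.ext) :
    H.type.Finite :=
  haveI : Finite H.type := Finite.of_injective _ h
  Set.toFinite _

end Hypergraph

/-! ## Hypergraph transformation systems -/

/-- Hypergraph transformation rules `lhs → rhs`. -/
structure HTRule (A : TypedAlphabet.{u, v} Sel) where
  lhs : Hypergraph A
  rhs : Hypergraph A
  type_eq : lhs.type = rhs.type
  lhs_injective : Function.Injective lhs.ext
  rhs_injective : Function.Injective rhs.ext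

namespace HTRule

variable {A : TypedAlphabet.{u, v} Sel}

theorem finite_type (r : HTRule A) : r.lhs.type.Finite :=
  r.lhs.finite_type_of_injective r.lhs_injective

/-- `G` is transformed into `G'` via `r`: up to isomorphism, `G = K[e/lhs]` and `G' = K[e/rhs]`
for some hypergraph `K` and some hyperedge `e` of `K` with an injective attachment function.
The label of `e` is irrelevant; to have a label of the right type at one's disposal in any case,
`K` may use one new symbol, of the type of the rule. -/
def Step (r : HTRule A) (G G' : Hypergraph A) : Prop :=
  ∃ (K : Hypergraph (A.addSymbol r.lhs.type r.finite_type)) (e : K.E)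
    (h : (A.addSymbol r.lhs.type r.finite_type).type (K.lab e) = r.lhs.type)
    (h' : (A.addSymbol r.lhs.type r.finite_type).type (K.lab e) = r.rhs.type),
    Function.Injective (K.att e) ∧
    (G.lift r.lhs.type r.finite_type).Iso
      (K.replace e (r.lhs.lift r.lhs.type r.finite_type) h) ∧
    (G'.lift r.lhs.type r.finite_type).Iso
      (K.replace e (r.rhs.lift r.lhs.type r.finite_type) h')

end HTRule

/-- Hypergraph transformation systems `⟨N, T, P, S⟩`; the nonterminal and the terminal symbols
form finite subsets of a common typed alphabet `A`. -/
structure HTSystem (A : TypedAlphabet.{u, v} Sel) where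
  N : Set A.Symbol
  T : Set A.Symbol
  finite_N : N.Finite
  finite_T : T.Finite
  P : Set (HTRule A)
  finite_P : P.Finite
  lhs_over : ∀ r ∈ P, r.lhs.Over (N ∪ T)
  rhs_over : ∀ r ∈ P, r.rhs.Over (N ∪ T)
  S : Hypergraph A
  S_over : S.Over (N ∪ T)
  S_injective : Function.Injective S.ext

namespace HTSystem

variable {A : TypedAlphabet.{u, v} Sel}

/-- `𝒢.DerivesIn n G H`: there is a derivation of (a hypergraph isomorphic to) `H` from `G` that
consists of exactly `n` applications of rules of `𝒢`. -/
inductive DerivesIn (𝒢 : HTSystem A) : ℕ → Hypergraph A → Hypergraph A → Prop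
  | refl {G H : Hypergraph A} : G.Iso H → DerivesIn 𝒢 0 G H
  | step {n : ℕ} {G H H' : Hypergraph A} {r : HTRule A} :
      DerivesIn 𝒢 n G H → r ∈ 𝒢.P → r.Step H H' → DerivesIn 𝒢 (n + 1) G H'

/-- The language generated by a hypergraph transformation system. -/
def language (𝒢 : HTSystem A) : Set (Hypergraph A) :=
  {H | H.Over 𝒢.T ∧ ∃ n, 𝒢.DerivesIn n 𝒢.S H}

/-- Linear-time hypergraph transformation systems. -/
def LinearTime (𝒢 : HTSystem A) : Prop :=
  ∃ c : ℕ, ∀ H ∈ 𝒢.language, ∃ n, n ≤ c * H.size ∧ 𝒢.DerivesIn n 𝒢.S H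

end HTSystem

/-! ## First-order multiplicative intuitionistic linear logic -/

/-- Predicate symbols: there are countably many of each arity. -/
structure PredSymbol where
  index : ℕ
  arity : ℕ

/-- Formulae of MILL1 with free variables in `α`, modulo renaming of bound variables.
`PreFormula α n` has `n` further variables, the elements of `Fin n`, that are to be bound by
quantifiers further outside (as in `FirstOrder.Language.BoundedFormula`); the variable bound by
the quantifier in `ex A` and `all A`, for `A : PreFormula α (n + 1)`, is the last element of
`Fin (n + 1)`. -/
inductive PreFormula (α : Type u) : ℕ → Type u
  | atom {n : ℕ} (p : PredSymbol) (args : Fin p.arity → α ⊕ Fin n) : PreFormula α n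
  | tensor {n : ℕ} (A B : PreFormula α n) : PreFormula α n
  | lolli {n : ℕ} (A B : PreFormula α n) : PreFormula α n
  | ex {n : ℕ} (A : PreFormula α (n + 1)) : PreFormula α n
  | all {n : ℕ} (A : PreFormula α (n + 1)) : PreFormula α n

/-- Formulae of MILL1 whose free variables belong to `α`. -/
abbrev Formula (α : Type u) : Type u := PreFormula α 0

namespace PreFormula

/-- The substitution `A[h]` of the variables `h x` for the free variables `x` of `A`. -/
def subst {α : Type u} {β : Type v} (h : α → β) : {n : ℕ} → PreFormula α n → PreFormula β n
  | _, atom p args => atom p (fun i => Sum.map h id (args i))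
  | _, tensor A B => tensor (A.subst h) (B.subst h)
  | _, lolli A B => lolli (A.subst h) (B.subst h)
  | _, ex A => ex (A.subst h)
  | _, all A => all (A.subst h)

/-- `A.inst y` is the result of replacing the variable `0 : Fin (n + 1)` by `y` (and renumbering
the others). For `A : PreFormula α 1` this is `A[y/x]`, where `x` is the variable bound by the
quantifier in `ex A` and `all A`. -/
def inst {α : Type u} (y : α) : {n : ℕ} → PreFormula α (n + 1) → PreFormula α n
  | _, atom p args =>
      atom p (fun i => Sum.elim Sum.inl (Fin.cases (Sum.inl y) Sum.inr) (args i))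
  | _, tensor A B => tensor (A.inst y) (B.inst y)
  | _, lolli A B => lolli (A.inst y) (B.inst y)
  | _, ex A => ex (A.inst y)
  | _, all A => all (A.inst y)

/-- `A.FreeIn x`: the variable `x` occurs free in `A`. -/
def FreeIn {α : Type u} (x : α) : {n : ℕ} → PreFormula α n → Prop
  | _, atom _ args => ∃ i, args i = Sum.inl x
  | _, tensor A B => A.FreeIn x ∨ B.FreeIn x
  | _, lolli A B => A.FreeIn x ∨ B.FreeIn x
  | _, ex A => A.FreeIn x
  | _, all A => A.FreeIn x

end PreFormula

/-- The countably infinite set of logical variables. -/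
abbrev Var : Type := ℕ

/-- Derivability of the sequent `Γ ⊢ C` in MILL1. -/
inductive Derivable : Multiset (Formula Var) → Formula Var → Prop
  | ax (A : Formula Var) : Derivable {A} A
  | tensorL {Γ : Multiset (Formula Var)} {A B C : Formula Var} :
      Derivable (A ::ₘ B ::ₘ Γ) C → Derivable (A.tensor B ::ₘ Γ) C
  | tensorR {Γ Δ : Multiset (Formula Var)} {A B : Formula Var} :
      Derivable Γ A → Derivable Δ B → Derivable (Γ + Δ) (A.tensor B)
  | lolliL {Γ Δ : Multiset (Formula Var)} {A B C : Formula Var} :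
      Derivable Δ B → Derivable (A ::ₘ Γ) C → Derivable (B.lolli A ::ₘ (Γ + Δ)) C
  | lolliR {Γ : Multiset (Formula Var)} {A B : Formula Var} :
      Derivable (B ::ₘ Γ) A → Derivable Γ (B.lolli A)
  | exL {Γ : Multiset (Formula Var)} {A : PreFormula Var 1} {B : Formula Var} (z : Var) :
      (∀ D ∈ Γ, ¬ D.FreeIn z) → ¬ A.FreeIn z → ¬ B.FreeIn z →
      Derivable (A.inst z ::ₘ Γ) B → Derivable (A.ex ::ₘ Γ) B
  | exR {Γ : Multiset (Formula Var)} {A : PreFormula Var 1} (y : Var) :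
      Derivable Γ (A.inst y) → Derivable Γ A.ex
  | allL {Γ : Multiset (Formula Var)} {A : PreFormula Var 1} {B : Formula Var} (y : Var) :
      Derivable (A.inst y ::ₘ Γ) B → Derivable (A.all ::ₘ Γ) B
  | allR {Γ : Multiset (Formula Var)} {A : PreFormula Var 1} (z : Var) :
      (∀ D ∈ Γ, ¬ D.FreeIn z) → ¬ A.FreeIn z →
      Derivable Γ (A.inst z) → Derivable Γ A.all

/-! ## Hypergraph MILL1 grammars -/

/-- The multiset `{f i | i ∈ ι}`, for a finite index set `ι`. -/
noncomputable def multisetOf {ι : Type} [Finite ι] {α : Type} (f : ι → α) : Multiset α :=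
  (@Finset.univ ι (Fintype.ofFinite ι)).val.map f

/-- Hypergraph MILL1 grammars `⟨T, S, X, ▷⟩`. The set of `A` with `a ▷ A` is `edge a`, where the
free variables of `A` belong to the type of `a`; the set of `A` with `• ▷ A` is `node`, where the
only element of `Unit` stands for the variable `x_•`. -/
structure MILL1Grammar (A : TypedAlphabet.{u, v} Sel) where
  T : Set A.Symbol
  finite_T : T.Finite
  X : Set Sel
  S : Formula X
  edge : (a : A.Symbol) → Set (Formula (A.type a))
  edge_subset : ∀ a, (edge a).Nonempty → a ∈ T
  finite_edge : ∀ a, (edge a).Finite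
  node : Set (Formula Unit)
  finite_node : node.Finite

/-- The language generated by a hypergraph MILL1 grammar. The injection `ι` realizes the nodes of
`H` as logical variables. -/
def MILL1Grammar.language {A : TypedAlphabet.{u, v} Sel} (𝒢 : MILL1Grammar A) :
    Set (Hypergraph A) :=
  {H | H.Over 𝒢.T ∧ ∃ hX : 𝒢.X = H.type, ∃ ι : H.V → Var, Function.Injective ι ∧
    ∃ (hV : H.V → Formula Unit) (hE : (e : H.E) → Formula (A.type (H.lab e))),
      (∀ v, hV v ∈ 𝒢.node) ∧ (∀ e, hE e ∈ 𝒢.edge (H.lab e)) ∧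
      Derivable
        (multisetOf (fun e => (hE e).subst (fun σ => ι (H.att e σ))) +
          multisetOf (fun v => (hV v).subst (fun _ => ι v)))
        (𝒢.S.subst (fun σ => ι (H.ext ⟨σ.1, hX ▸ σ.2⟩)))}

end HG

/-!
Derivations are simulated backwards. A configuration (a multiset of nodes and hyperedges) is
written as a tensor product of atoms, one for each node and one for each hyperedge, and the rule
`lhs → rhs` becomes the closed formula `ruleFormula`, "for all nodes of `rhs`, `rhs` implies that
there are internal nodes of `lhs` such that `lhs`". As MILL1 has no exponentials, a formula is used
exactly once. So each node and each hyperedge of the generated hypergraph contributes, besides its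
own atom, the formulae of at most `c` rules of its choice, where `c` is the constant of the
linear-time system; that suffices for a derivation with at most `c * |H|` steps. The right-hand
side of the sequent describes the start hypergraph (`goalFormula`). The atoms for nodes are
essential: since each of them is available once only, the variables in an instance of a rule
denote distinct nodes, and a node that has been consumed cannot be the end of a hyperedge that is
left over. A nullary atom `token` stands in for the missing unit of the tensor product.

That every generated hypergraph has a derivation in MILL1 is shown by induction on its derivation
in the system (`HTSystem.DerivesIn.exists_derivable`, with `Derivable.ruleFormula_left` for one
step).

The converse needs no analysis of MILL1 proofs. MILL1 is sound for phase semantics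
(`Derivable.sem_subset`), and a suitable phase space consists of the monoid of configurations and
of the set `pole` of those configurations `c` such that, if no node occurs twice in `c`, then `c`
describes a hypergraph derivable in the system. In this space, the formulae of the rules are valid
(`zero_mem_sem_ruleFormula`), the goal formula is interpreted inside the pole
(`sem_goalFormula_subset`), and the formulae of the nodes and hyperedges of `H` contain the
corresponding single-atom configurations. Hence a derivable sequent puts the configuration of `H`
into the pole.

Both directions rely on a description of the transformation steps by configurations instead of
quotients (`HTRule.Step.of_config` and `HTRule.Step.exists_config`).
-/

universe w

namespace HG

/-! ### Finite families -/

/-- The multiset of the values of a finite family; `multisetOf` without restrictions on the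
universes. -/
noncomputable def family {ι : Type*} [Finite ι] {α : Type*} (f : ι → α) : Multiset α :=
  (@Finset.univ ι (Fintype.ofFinite ι)).val.map f

section Family

variable {ι κ α β : Type*} [Finite ι] [Finite κ]

theorem family_eq [Fintype ι] (f : ι → α) : family f = Finset.univ.val.map f := by
  unfold family
  congr!

theorem multisetOf_eq_family {ι α : Type} [Finite ι] (f : ι → α) : multisetOf f = family f := rfl

theorem family_comp_equiv (e : ι ≃ κ) (f : κ → α) : family (fun i => f (e i)) = family f := by
  cases nonempty_fintype ι
  cases nonempty_fintype κ
  rw [family_eq, family_eq, ← Multiset.map_univ_val_equiv e, Multiset.map_map]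
  rfl

theorem map_family (g : α → β) (f : ι → α) :
    (family f).map g = family (fun i => g (f i)) := by
  simp [family]

theorem mem_family {f : ι → α} {a : α} : a ∈ family f ↔ ∃ i, f i = a := by
  simp [family]

theorem nodup_family {f : ι → α} : (family f).Nodup ↔ Function.Injective f := by
  cases nonempty_fintype ι
  rw [family_eq]
  exact Fintype.nodup_map_univ_iff_injective

theorem family_sum (f : ι ⊕ κ → α) :
    family f = family (fun i => f (Sum.inl i)) + family (fun k => f (Sum.inr k)) := by
  cases nonempty_fintype ι
  cases nonempty_fintype κ
  simp only [family_eq]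
  rw [← Finset.univ_disjSum_univ]
  simp [Finset.disjSum, Multiset.disjSum, Multiset.map_map]

theorem family_subtype_ne (f : ι → α) (i : ι) :
    family f = f i ::ₘ family (fun j : {j // j ≠ i} => f j) := by
  classical
  cases nonempty_fintype ι
  have h := family_comp_equiv (Equiv.optionSubtypeNe i) f
  rw [← h, family_eq, family_eq, univ_option]
  simp [Finset.insertNone, Multiset.map_map]
  rfl

theorem exists_equiv_of_family_eq {f : ι → α} {g : κ → α} (h : family f = family g) :
    ∃ e : ι ≃ κ, ∀ i, g (e i) = f i := by
  classical
  cases nonempty_fintype ι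
  cases nonempty_fintype κ
  rw [family_eq, family_eq] at h
  have hc : ∀ a, Nonempty ({i // f i = a} ≃ {k // g k = a}) := by
    intro a
    rw [← Fintype.card_eq, Fintype.card_subtype, Fintype.card_subtype]
    have := congrArg (Multiset.count a) h
    simp only [Multiset.count_map] at this
    simpa [Finset.card, Finset.filter, eq_comm] using this
  -- Match the fibres of `f` and `g`, which have the same numbers of elements.
  let e : ι ≃ κ := (Equiv.sigmaFiberEquiv f).symm.trans
    ((Equiv.sigmaCongrRight fun a => (hc a).some).trans (Equiv.sigmaFiberEquiv g))
  exact ⟨e, fun i => ((hc (f i)).some ⟨i, rfl⟩).2⟩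

theorem exists_family_eq (m : Multiset α) : ∃ (n : ℕ) (f : Fin n → α), family f = m := by
  induction m using Quotient.inductionOn with
  | h l => exact ⟨l.length, l.get, by simp [family_eq]⟩

/-- The values of a family can be distributed over the fibres of an injection and its
complement. -/
theorem family_eq_add_compl {e : ι → κ} (he : Function.Injective e) (f : κ → α) :
    family f = family (fun i => f (e i)) + family (fun k : {k // k ∉ Set.range e} => f k) := by
  classical
  have h := family_comp_equiv
    (((Equiv.ofInjective e he).sumCongr (Equiv.refl _)).trans
      (Equiv.Set.sumCompl (Set.range e))) f
  rw [← h, family_sum]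
  rfl

end Family

/-- A list of at most `c * |ι|` elements can be cut into `|ι|` lists of length at most `c`. -/
theorem exists_family_bind_eq {ι : Type*} [Finite ι] {α : Type*} (c : ℕ) (l : List α)
    (hl : l.length ≤ c * Nat.card ι) :
    ∃ L : ι → List α, (∀ i, (L i).length ≤ c) ∧
      (family L).bind (fun l => (l : Multiset α)) = l := by
  cases nonempty_fintype ι
  have key : ∀ (n : ℕ) (l : List α), l.length ≤ c * n → ∃ L : Fin n → List α,
      (∀ i, (L i).length ≤ c) ∧ (List.ofFn L).flatten = l := by
    intro n
    induction n with
    | zero => intro l hl; exact ⟨Fin.elim0, fun i => i.elim0, by simp_all⟩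
    | succ n ih =>
      intro l hl
      obtain ⟨L, h1, h2⟩ := ih (l.drop c) (by rw [List.length_drop]; lia)
      refine ⟨Fin.cons (l.take c) L, ?_, ?_⟩
      · intro i
        refine Fin.cases ?_ (fun i => ?_) i
        · simp
        · simpa using h1 i
      · simp [List.ofFn_succ, h2]
  obtain ⟨L, h1, h2⟩ := key (Nat.card ι) l hl
  refine ⟨fun i => L (Finite.equivFin ι i), fun i => h1 _, ?_⟩
  rw [family_comp_equiv (Finite.equivFin ι) L, family_eq, Fin.univ_val_map, ← h2]
  generalize List.ofFn L = K
  induction K with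
  | nil => simp
  | cons a K ih => rw [← Multiset.cons_coe, Multiset.cons_bind, ih]; simp

/-! ### Configurations -/

variable {Sel : Type u}

instance (A : TypedAlphabet.{u, v} Sel) (a : A.Symbol) : Finite (A.type a) := A.finite_type a

/-- A symbol together with a function from its type to `D`: a hyperedge whose attachment nodes are
elements of `D`. -/
abbrev Link (A : TypedAlphabet.{u, v} Sel) (D : Type) := Σ a : A.Symbol, (A.type a → D)

/-- A configuration consists of a multiset of nodes and a multiset of hyperedges. The nodes may be
repeated, and the hyperedges may be attached to elements of `D` that are not nodes. Such defective
configurations are needed in order that configurations form a commutative monoid. -/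
abbrev Config (A : TypedAlphabet.{u, v} Sel) (D : Type) := Multiset D × Multiset (Link A D)

variable {A : TypedAlphabet.{u, v} Sel} {D : Type}

theorem link_eq_iff {a b : A.Symbol} {t : A.type a → D} {t' : A.type b → D} :
    (⟨a, t⟩ : Link A D) = ⟨b, t'⟩ ↔ a = b ∧ ∀ σ h h', t ⟨σ, h⟩ = t' ⟨σ, h'⟩ := by
  constructor
  · intro h
    cases h
    exact ⟨rfl, fun _ _ _ => rfl⟩
  · rintro ⟨rfl, h⟩
    congr 1
    funext σ
    exact h _ _ _

/-- A hyperedge over `A` seen as a hyperedge over `A` with one more symbol. -/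
def liftLink (X : Set Sel) (hX : X.Finite) (l : Link A D) : Link (A.addSymbol X hX) D :=
  ⟨some l.1, l.2⟩

theorem liftLink_injective (X : Set Sel) (hX : X.Finite) :
    Function.Injective (liftLink (A := A) (D := D) X hX) := by
  rintro ⟨a, t⟩ ⟨b, t'⟩ h
  have h := (link_eq_iff (A := A.addSymbol X hX)).1 h
  exact link_eq_iff.2 ⟨Option.some.inj h.1, h.2⟩

namespace Hypergraph

/-- The hyperedge `e` of `H`, where the node `v` is replaced by `f v`. -/
def link (H : Hypergraph A) (f : H.V → D) (e : H.E) : Link A D :=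
  ⟨H.lab e, fun σ => f (H.att e σ)⟩

/-- The configuration that describes `H` when the node `v` is represented by `f v`. -/
noncomputable def config (H : Hypergraph A) (f : H.V → D) : Config A D :=
  (family f, family (H.link f))

theorem config_lift (H : Hypergraph A) (X : Set Sel) (hX : X.Finite) (f : H.V → D) :
    (H.lift X hX).config f = (family f, (family (H.link f)).map (liftLink X hX)) := by
  rw [map_family]
  rfl

/-- Hypergraphs with the same configuration are isomorphic, provided that the nodes of the second
one are represented injectively. -/
theorem Iso.of_config {G H : Hypergraph A} {f : G.V → D} {g : H.V → D}
    (hg : Function.Injective g) (hc : G.config f = H.config g)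
    (ht : G.type = H.type) (hext : ∀ σ h h', f (G.ext ⟨σ, h⟩) = g (H.ext ⟨σ, h'⟩)) :
    G.Iso H := by
  obtain ⟨φ, hφ⟩ := exists_equiv_of_family_eq (congrArg Prod.fst hc)
  obtain ⟨ψ, hψ⟩ := exists_equiv_of_family_eq (congrArg Prod.snd hc)
  refine ⟨ht, φ, ψ, fun e => (link_eq_iff.1 (hψ e)).1, fun e σ h h' => hg ?_,
    fun σ h h' => hg ?_⟩
  · rw [hφ]
    exact (link_eq_iff.1 (hψ e)).2 σ h' h
  · rw [hφ]
    exact (hext σ h h').symm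

theorem Iso.exists_equiv {G H : Hypergraph A} (hi : G.Iso H) :
    ∃ φ : G.V ≃ H.V, (∀ f : H.V → D, G.config (fun v => f (φ v)) = H.config f) ∧
      ∀ σ h h', φ (G.ext ⟨σ, h⟩) = H.ext ⟨σ, h'⟩ := by
  obtain ⟨-, φ, ψ, h1, h2, h3⟩ := hi
  refine ⟨φ, fun f => Prod.ext (family_comp_equiv φ f) ?_, fun σ h h' => (h3 σ h h').symm⟩
  change family _ = family _
  rw [← family_comp_equiv ψ (H.link f)]
  congr 1
  funext e
  exact link_eq_iff.2 ⟨(h1 e).symm, fun σ h h' => by rw [h2 e σ h h']⟩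

/-- Every configuration without defects is the configuration of a hypergraph. -/
theorem exists_config_eq (c : Config A D) (hn : c.1.Nodup) (hl : ∀ l ∈ c.2, ∀ σ, l.2 σ ∈ c.1)
    (X : Set Sel) (d : X → D) (hd : ∀ σ, d σ ∈ c.1) :
    ∃ (H : Hypergraph A) (f : H.V → D), Function.Injective f ∧ H.config f = c ∧ H.type = X ∧
      ∀ σ h h', f (H.ext ⟨σ, h⟩) = d ⟨σ, h'⟩ := by
  obtain ⟨n, l, hln⟩ := exists_family_eq c.2
  have hl' : ∀ i σ, (l i).2 σ ∈ c.1 := fun i => hl _ (hln ▸ mem_family.2 ⟨i, rfl⟩)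
  have hfin : Finite {x // x ∈ c.1} := by
    classical
    exact Finite.of_equiv _ (Equiv.subtypeEquivRight fun x => Multiset.mem_toFinset (s := c.1))
  refine ⟨{ V := {x // x ∈ c.1}, E := Fin n, finite_V := hfin, finite_E := inferInstance,
            lab := fun i => (l i).1, att := fun i σ => ⟨(l i).2 σ, hl' i σ⟩,
            type := X, ext := fun σ => ⟨d σ, hd σ⟩ }, Subtype.val, Subtype.val_injective,
          Prod.ext ?_ hln, rfl, fun _ _ _ => rfl⟩
  classical
  refine (Multiset.Nodup.ext (nodup_family.2 Subtype.val_injective) hn).2 fun x => ?_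
  rw [mem_family]
  exact ⟨fun ⟨y, hy⟩ => hy ▸ y.2, fun hx => ⟨⟨x, hx⟩, rfl⟩⟩

/-! ### Hyperedge replacement -/

section Replace

variable (K : Hypergraph A) (e : K.E) (L : Hypergraph A) (h : A.type (K.lab e) = L.type)

/-- The node of `K[e/L]` that stems from a node of `K`. -/
def replaceInl (x : K.V) : (K.replace e L h).V := Quot.mk (GlueRel K e L h) (Sum.inl x)

/-- The node of `K[e/L]` that stems from a node of `L`. -/
def replaceInr (x : L.V) : (K.replace e L h).V := Quot.mk (GlueRel K e L h) (Sum.inr x)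

theorem replaceInl_att (σ : Sel) (h1 : σ ∈ A.type (K.lab e)) (h2 : σ ∈ L.type) :
    replaceInl K e L h (K.att e ⟨σ, h1⟩) = replaceInr K e L h (L.ext ⟨σ, h2⟩) :=
  Quot.sound ⟨⟨σ, h1⟩, rfl, rfl⟩

open Classical in
/-- The nodes of `K[e/L]` are the nodes of `K` and the internal nodes of `L`. -/
noncomputable def replaceEquiv (hL : Function.Injective L.ext) :
    K.V ⊕ {v // v ∉ Set.range L.ext} ≃ (K.replace e L h).V where
  toFun := Sum.elim (replaceInl K e L h) (fun v => replaceInr K e L h v)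
  invFun := Quot.lift
    (Sum.elim Sum.inl fun v =>
      if hv : v ∈ Set.range L.ext then Sum.inl (K.att e ⟨hv.choose.1, h.symm.subset hv.choose.2⟩)
      else Sum.inr ⟨v, hv⟩)
    (by
      rintro _ _ ⟨σ, rfl, rfl⟩
      have hv : L.ext ⟨σ.1, h.subset σ.2⟩ ∈ Set.range L.ext := ⟨_, rfl⟩
      have hc := hL hv.choose_spec
      simp only [Sum.elim_inl, Sum.elim_inr, dif_pos hv]
      congr 2
      exact Subtype.ext (congrArg Subtype.val hc).symm)
  left_inv := by
    rintro (x | ⟨v, hv⟩)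
    · rfl
    · exact dif_neg hv
  right_inv := by
    rintro ⟨x | v⟩
    · rfl
    · by_cases hv : v ∈ Set.range L.ext
      · simp only [Sum.elim_inr, dif_pos hv, Sum.elim_inl]
        refine (replaceInl_att K e L h _ _ hv.choose.2).trans ?_
        rw [Subtype.coe_eta, hv.choose_spec]
        rfl
      · simp only [Sum.elim_inr, dif_neg hv]
        rfl

theorem config_replace (hL : Function.Injective L.ext) (f : (K.replace e L h).V → D) :
    (K.replace e L h).config f =
      (family (fun x => f (replaceInl K e L h x)) +
        family (fun v : {v // v ∉ Set.range L.ext} => f (replaceInr K e L h v)),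
       family (fun e' : {e' // e' ≠ e} => K.link (fun x => f (replaceInl K e L h x)) e') +
        family (L.link (fun v => f (replaceInr K e L h v)))) := by
  refine Prod.ext ?_ ?_
  · change family f = _
    rw [← family_comp_equiv (replaceEquiv K e L h hL), family_sum]
    rfl
  · exact family_sum (fun x => (K.replace e L h).link f x)

/-- Functions on the nodes of `K` and of `L` that agree on the nodes to be glued together define a
function on the nodes of `K[e/L]`. -/
theorem exists_replace_map (g : K.V → D) (s : L.V → D)
    (hs : ∀ σ h1 h2, g (K.att e ⟨σ, h1⟩) = s (L.ext ⟨σ, h2⟩)) :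
    ∃ f : (K.replace e L h).V → D,
      (∀ x, f (replaceInl K e L h x) = g x) ∧ ∀ v, f (replaceInr K e L h v) = s v :=
  ⟨Quot.lift (Sum.elim g s) (by rintro _ _ ⟨σ, rfl, rfl⟩; exact hs _ _ _),
    fun _ => rfl, fun _ => rfl⟩

end Replace

theorem family_eq_add_internal (L : Hypergraph A) [Finite L.type] (hL : Function.Injective L.ext)
    (s : L.V → D) :
    family s = family (fun σ => s (L.ext σ)) +
      family (fun v : {v // v ∉ Set.range L.ext} => s v) :=
  family_eq_add_compl hL s

/-- If `G` consists of a copy of `L` and of the hyperedges and nodes of `K` apart from `e` and its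
attachment nodes, then `G` is isomorphic to `K[e/L]`. -/
theorem lift_iso_replace {X : Set Sel} {hX : X.Finite} {K : Hypergraph (A.addSymbol X hX)}
    {e : K.E} {G L : Hypergraph A} (h : (A.addSymbol X hX).type (K.lab e) = L.type)
    (hL : Function.Injective L.ext) {f : G.V → D} (hf : Function.Injective f)
    {g : K.V → D} {s : L.V → D} {C : Config A D} (hG : G.config f = C + L.config s)
    (hs : ∀ σ h1 h2, g (K.att e ⟨σ, h1⟩) = s (L.ext ⟨σ, h2⟩))
    (hV : family g = C.1 + family (fun σ => g (K.att e σ)))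
    (hE : family (fun e' : {e' // e' ≠ e} => K.link g e') = C.2.map (liftLink X hX))
    (ht : G.type = K.type) (hext : ∀ σ h h', f (G.ext ⟨σ, h⟩) = g (K.ext ⟨σ, h'⟩)) :
    (G.lift X hX).Iso (K.replace e (L.lift X hX) h) := by
  have : Finite L.type := Finite.of_injective _ hL
  obtain ⟨F, hF1, hF2⟩ := exists_replace_map K e (L.lift X hX) h g s hs
  have hc : (G.lift X hX).config f = (K.replace e (L.lift X hX) h).config F := by
    rw [config_replace K e (L.lift X hX) h hL F, config_lift]
    have h1 := congrArg Prod.fst hG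
    have h2 := congrArg Prod.snd hG
    simp only [config, Prod.fst_add, Prod.snd_add] at h1 h2
    refine Prod.ext ?_ ?_
    · simp only [hF1, hF2]
      rw [h1, hV, family_eq_add_internal L hL s, add_assoc]
      congr 2
      rw [← family_comp_equiv (Equiv.setCongr h)]
      congr 1
      funext σ
      exact (hs _ _ _).symm
    · simp only [hF1, hF2]
      rw [h2, Multiset.map_add, hE, map_family]
      rfl
  refine Iso.of_config ?_ hc ht ?_
  · have hV' : family f = family F := congrArg Prod.fst hc
    exact nodup_family.1 (hV' ▸ nodup_family.2 hf)
  · intro σ h1 h2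
    exact (hext σ h1 h2).trans (hF1 _).symm

end Hypergraph

/-! ### Transformation steps -/

open HG.Hypergraph

/-- A hypergraph may be transformed via `r` by exchanging a copy of the left-hand side for one of
the right-hand side, provided that the internal nodes of the copy are not external nodes of the
hypergraph and that the hyperedges outside the copy are not attached to them. -/
theorem HTRule.Step.of_config {r : HTRule A} {G G' : Hypergraph A} {f : G.V → D} {f' : G'.V → D}
    (hf : Function.Injective f) (hf' : Function.Injective f') {C : Config A D}
    {s : r.lhs.V → D} {s' : r.rhs.V → D} (hG : G.config f = C + r.lhs.config s)
    (hG' : G'.config f' = C + r.rhs.config s')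
    (hs : ∀ σ h h', s (r.lhs.ext ⟨σ, h⟩) = s' (r.rhs.ext ⟨σ, h'⟩))
    (ht : G.type = G'.type) (hext : ∀ σ h h', f (G.ext ⟨σ, h⟩) = f' (G'.ext ⟨σ, h'⟩))
    (hfresh : ∀ v ∉ Set.range r.lhs.ext,
      (∀ l ∈ C.2, ∀ σ, l.2 σ ≠ s v) ∧ ∀ σ, f (G.ext σ) ≠ s v) :
    r.Step G G' := by
  have : Finite r.lhs.type := Finite.of_injective _ r.lhs_injective
  have hV := congrArg Prod.fst hG
  have hE := congrArg Prod.snd hG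
  simp only [config, Prod.fst_add, Prod.snd_add] at hV hE
  have hnd : (C.1 + family s).Nodup := hV ▸ nodup_family.2 hf
  have hsi : Function.Injective s := nodup_family.1 (Multiset.nodup_add.1 hnd).2.1
  have hVs := r.lhs.family_eq_add_internal r.lhs_injective s
  -- `K` has the nodes of `G` except the internal nodes of the copy of the left-hand side.
  set N : Multiset D := C.1 + family (fun σ => s (r.lhs.ext σ)) with hN
  have hmem : ∀ x, (∃ v, f v = x) → (∀ v ∉ Set.range r.lhs.ext, x ≠ s v) → x ∈ N := by
    rintro x hx hxs
    have hx' : x ∈ C.1 + family s := hV ▸ mem_family.2 hx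
    rcases Multiset.mem_add.1 hx' with h | h
    · exact Multiset.mem_add.2 (Or.inl h)
    · obtain ⟨v, rfl⟩ := mem_family.1 h
      by_cases hv : v ∈ Set.range r.lhs.ext
      · obtain ⟨σ, rfl⟩ := hv
        exact Multiset.mem_add.2 (Or.inr (mem_family.2 ⟨σ, rfl⟩))
      · exact absurd rfl (hxs v hv)
  let l₀ : Link (A.addSymbol r.lhs.type r.finite_type) D := ⟨none, fun σ => s (r.lhs.ext σ)⟩
  obtain ⟨K, g, hg, hK, hKt, hKe⟩ := exists_config_eq
    (A := A.addSymbol r.lhs.type r.finite_type)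
    (N, l₀ ::ₘ C.2.map (liftLink r.lhs.type r.finite_type))
    (by
      rw [hVs, ← add_assoc] at hnd
      exact (Multiset.nodup_add.1 hnd).1)
    (by
      intro l hl σ
      rcases Multiset.mem_cons.1 hl with rfl | hl
      · exact Multiset.mem_add.2 (Or.inr (mem_family.2 ⟨σ, rfl⟩))
      · obtain ⟨l, hlC, rfl⟩ := Multiset.mem_map.1 hl
        have hl' : l ∈ family (G.link f) := hE ▸ Multiset.mem_add.2 (Or.inl hlC)
        obtain ⟨e, he⟩ := mem_family.1 hl'
        refine hmem _ ?_ fun v hv => (hfresh v hv).1 l hlC σ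
        subst he
        exact ⟨_, rfl⟩)
    G.type (fun σ => f (G.ext σ))
    (fun σ => hmem _ ⟨_, rfl⟩ fun v hv => (hfresh v hv).2 σ)
  have hKV := congrArg Prod.fst hK
  have hKE := congrArg Prod.snd hK
  simp only [config] at hKV hKE
  obtain ⟨e, he⟩ := mem_family.1 (hKE ▸ Multiset.mem_cons_self l₀ _)
  obtain ⟨hlab, hatt⟩ := link_eq_iff.1 he
  rw [family_subtype_ne _ e, he] at hKE
  have hKE := Multiset.cons_inj_right l₀ |>.1 hKE
  have h : (A.addSymbol r.lhs.type r.finite_type).type (K.lab e) = r.lhs.type := by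
    rw [hlab]; rfl
  have hKV' : family g = C.1 + family (fun σ => g (K.att e σ)) := by
    rw [hKV, hN, ← family_comp_equiv (Equiv.setCongr h)]
    congr 2
    funext σ
    exact (hatt _ _ _).symm
  refine ⟨K, e, h, h.trans r.type_eq, ?_, ?_, ?_⟩
  · rintro ⟨σ, hσ⟩ ⟨τ, hτ⟩ hστ
    have := congrArg g hστ
    rw [hatt σ hσ (h.subset hσ), hatt τ hτ (h.subset hτ)] at this
    have := congrArg Subtype.val (r.lhs_injective (hsi this))
    exact Subtype.ext this
  · exact lift_iso_replace h r.lhs_injective hf hG (fun σ h1 h2 => hatt σ h1 h2) hKV' hKE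
      hKt.symm fun σ h1 h2 => (hKe σ h2 h1).symm
  · refine lift_iso_replace (h.trans r.type_eq) r.rhs_injective hf' hG' ?_ hKV' hKE
      (ht.symm.trans hKt.symm) ?_
    · intro σ h1 h2
      have h3 : σ ∈ r.lhs.type := r.type_eq.symm.subset h2
      exact (hatt σ h1 h3).trans (hs σ h3 h2)
    · intro σ h1 h2
      have h3 : σ ∈ G.type := ht.symm.subset h1
      exact (hext σ h3 h1).symm.trans (hKe σ h2 h3).symm

/-- If `G` is transformed into `G'` via `r`, then `G` arises from `G'` when a copy of the
right-hand side is exchanged for a copy of the left-hand side whose internal nodes are new. -/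
theorem HTRule.Step.exists_config {r : HTRule A} {G G' : Hypergraph A} (hstep : r.Step G G')
    {f' : G'.V → D} (hf' : Function.Injective f') {i : r.lhs.V → D} (hi : Function.Injective i)
    (hif : ∀ v x, i v ≠ f' x) :
    G.type = G'.type ∧ ∃ (f : G.V → D) (C : Config A D) (s : r.lhs.V → D) (s' : r.rhs.V → D),
      Function.Injective f ∧ (∀ σ h h', f (G.ext ⟨σ, h⟩) = f' (G'.ext ⟨σ, h'⟩)) ∧
      G.config f = C + r.lhs.config s ∧ G'.config f' = C + r.rhs.config s' ∧
      (∀ σ h h', s (r.lhs.ext ⟨σ, h⟩) = s' (r.rhs.ext ⟨σ, h'⟩)) ∧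
      ∀ v ∉ Set.range r.lhs.ext, s v = i v := by
  classical
  obtain ⟨K, e, h, h', hatt, hGi, hGi'⟩ := hstep
  have : Finite r.lhs.type := Finite.of_injective _ r.lhs_injective
  have : Finite r.rhs.type := Finite.of_injective _ r.rhs_injective
  obtain ⟨φ, hφ, hφe⟩ := hGi.exists_equiv (D := D)
  obtain ⟨φ', hφ', hφe'⟩ := hGi'.exists_equiv (D := D)
  -- The nodes of `K` are named as in `G'`; the nodes of the copy of the left-hand side are named as
  -- in `K` if they are external, and by `i` if they are internal.
  let F' := fun x => f' (φ'.symm x)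
  have hF' : Function.Injective F' := hf'.comp φ'.symm.injective
  let g : K.V → D := fun x => F' (replaceInl K e _ h' x)
  let s' : r.rhs.V → D := fun x => F' (replaceInr K e (r.rhs.lift _ _) h' x)
  have hg : Function.Injective g :=
    hF'.comp ((replaceEquiv K e _ h' r.rhs_injective).injective.comp Sum.inl_injective)
  let s : r.lhs.V → D := fun v =>
    if hv : v ∈ Set.range r.lhs.ext then g (K.att e ⟨hv.choose.1, h.symm.subset hv.choose.2⟩)
    else i v
  have hs : ∀ σ h1 h2, g (K.att e ⟨σ, h1⟩) = s (r.lhs.ext ⟨σ, h2⟩) := by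
    intro σ h1 h2
    have hv : r.lhs.ext ⟨σ, h2⟩ ∈ Set.range r.lhs.ext := ⟨_, rfl⟩
    have hc := r.lhs_injective hv.choose_spec
    simp only [s, dif_pos hv]
    congr 2
    exact Subtype.ext (congrArg Subtype.val hc).symm
  have hs' : ∀ σ h1 h2, g (K.att e ⟨σ, h1⟩) = s' (r.rhs.ext ⟨σ, h2⟩) := fun σ h1 h2 =>
    congrArg F' (replaceInl_att K e (r.rhs.lift _ _) h' σ h1 h2)
  have hsi : ∀ v ∉ Set.range r.lhs.ext, s v = i v := fun v hv => dif_neg hv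
  obtain ⟨F, hF1, hF2⟩ := exists_replace_map K e (r.lhs.lift _ _) h g s hs
  have hF : Function.Injective F := by
    have : Function.Injective (F ∘ replaceEquiv K e (r.lhs.lift _ _) h r.lhs_injective) := by
      rintro (x | ⟨v, hv⟩) (y | ⟨w, hw⟩) hxy
      · exact congrArg _ (hg ((hF1 x).symm.trans (hxy.trans (hF1 y))))
      · exact absurd ((hsi w hw).symm.trans ((hF2 w).symm.trans (hxy.symm.trans (hF1 x))))
          (hif _ _)
      · exact absurd ((hsi v hv).symm.trans ((hF2 v).symm.trans (hxy.trans (hF1 y))))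
          (hif _ _)
      · have := (hsi v hv).symm.trans ((hF2 v).symm.trans (hxy.trans ((hF2 w).trans (hsi w hw))))
        have := hi this
        subst this
        rfl
    simpa using this.comp (replaceEquiv K e (r.lhs.lift _ _) h r.lhs_injective).symm.injective
  let f : G.V → D := fun v => F (φ v)
  have ht : G.type = G'.type := hGi.1.trans hGi'.1.symm
  have hc := (config_lift G _ _ f).symm.trans
    ((hφ F).trans (config_replace K e _ h r.lhs_injective F))
  have hc' := hφ' F'
  simp only [F', Equiv.symm_apply_apply] at hc'
  have hc' := (config_lift G' _ _ f').symm.trans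
    (hc'.trans (config_replace K e _ h' r.rhs_injective F'))
  have hV := congrArg Prod.fst hc
  have hE := congrArg Prod.snd hc
  have hV' := congrArg Prod.fst hc'
  have hE' := congrArg Prod.snd hc'
  simp only [hF1, hF2] at hV hE
  change family f = family g + family (fun v : {v // v ∉ Set.range r.lhs.ext} => s v) at hV
  change family f' = family g + family (fun v : {v // v ∉ Set.range r.rhs.ext} => s' v) at hV'
  set M := family (fun e' : {e' // e' ≠ e} => K.link g e')
  have hl : family ((r.lhs.lift _ _).link s) =
      (family (r.lhs.link s)).map (liftLink _ r.finite_type) :=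
    (map_family (liftLink r.lhs.type r.finite_type) (r.lhs.link s)).symm
  have hr : family ((r.rhs.lift _ _).link s') =
      (family (r.rhs.link s')).map (liftLink _ r.finite_type) :=
    (map_family (liftLink r.lhs.type r.finite_type) (r.rhs.link s')).symm
  change (family (G.link f)).map (liftLink _ _) = M + family ((r.lhs.lift _ _).link s) at hE
  change (family (G'.link f')).map (liftLink _ _) = M + family ((r.rhs.lift _ _).link s') at hE'
  rw [hl] at hE
  rw [hr] at hE'
  -- The labels of the hyperedges outside the copies are symbols of `A`.
  obtain ⟨M₀, hM₀⟩ : ∃ M₀, M = Multiset.map (liftLink r.lhs.type r.finite_type) M₀ := by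
    have : ∀ x ∈ M, ∃ y, liftLink r.lhs.type r.finite_type y = x := by
      intro x hx
      have : x ∈ (family (G'.link f')).map (liftLink r.lhs.type r.finite_type) :=
        hE' ▸ Multiset.mem_add.2 (Or.inl hx)
      obtain ⟨y, -, hy⟩ := Multiset.mem_map.1 this
      exact ⟨y, hy⟩
    have hlift : CanLift _ (Link A D) (liftLink r.lhs.type r.finite_type)
      (fun x => ∃ y, liftLink r.lhs.type r.finite_type y = x) := ⟨fun _ h => h⟩
    exact ((Multiset.canLift _ _).prf M this).imp fun _ h => h.symm
  rw [hM₀, ← Multiset.map_add] at hE hE'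
  have hE := Multiset.map_injective (liftLink_injective _ _) hE
  have hE' := Multiset.map_injective (liftLink_injective _ _) hE'
  have hgV := family_eq_add_compl hatt g
  set N₀ := family (fun k : {k // k ∉ Set.range (K.att e)} => g k)
  refine ⟨ht, f, (N₀, M₀), s, s', hF.comp φ.injective, ?_, Prod.ext ?_ hE, Prod.ext ?_ hE',
    ?_, hsi⟩
  · intro σ h1 h2
    have h3 : σ ∈ K.type := hGi.1.subset h1
    change F (φ ((G.lift r.lhs.type r.finite_type).ext ⟨σ, h1⟩)) = _
    rw [hφe σ h1 h3, ← φ'.symm_apply_apply (G'.ext ⟨σ, h2⟩)]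
    refine (hF1 _).trans ?_
    exact congrArg F' (hφe' σ h2 h3).symm
  · change family f = N₀ + family s
    rw [hV, hgV, family_eq_add_internal _ r.lhs_injective s, add_comm _ N₀, add_assoc]
    congr 2
    rw [← family_comp_equiv (Equiv.setCongr h)]
    congr 1
    funext σ
    exact hs _ _ _
  · change family f' = N₀ + family s'
    rw [hV', hgV, family_eq_add_internal _ r.rhs_injective s', add_comm _ N₀, add_assoc]
    congr 2
    rw [← family_comp_equiv (Equiv.setCongr h')]
    congr 1
    funext σ
    exact hs' _ _ _
  · intro σ h1 h2
    have h3 : σ ∈ (A.addSymbol r.lhs.type r.finite_type).type (K.lab e) := h.symm.subset h1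
    exact (hs σ h3 h1).symm.trans (hs' σ h3 h2)

/-! ### Formulae with variables in place of nodes -/

/-- The terms that may occur in `PreFormula α n`: free variables, and variables to be bound
outside. -/
abbrev Term (α : Type w) (n : ℕ) := α ⊕ Fin n

/-- A formula with variables in `W`. It can be written down below any number of quantifiers, for
any choice of terms in place of the elements of `W`. -/
abbrev Schema (W : Type) (α : Type w) := ∀ n, (W → Term α n) → PreFormula α n

/-- The list of the elements of a finite type. -/
noncomputable def enum (ι : Type) [Finite ι] : List ι :=
  (@Finset.univ ι (Fintype.ofFinite ι)).toList

theorem mem_enum {ι : Type} [Finite ι] (i : ι) : i ∈ enum ι := by simp [enum]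

theorem nodup_enum (ι : Type) [Finite ι] : (enum ι).Nodup := Finset.nodup_toList _

theorem coe_map_enum {ι : Type} [Finite ι] {α : Type*} (f : ι → α) :
    (((enum ι).map f : List α) : Multiset α) = family f := by
  rw [← Multiset.map_coe, enum, Finset.coe_toList, family]

section Terms

variable {α : Type w} {β : Type v} {W : Type} {n : ℕ}

/-- The substitution of `y` for the first bound variable, as in `PreFormula.inst`. -/
def instTerm (y : α) : Term α (n + 1) → Term α n :=
  Sum.elim Sum.inl (Fin.cases (Sum.inl y) Sum.inr)

open Classical in
/-- Assign to `w` a variable bound by a new innermost quantifier. -/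
noncomputable def bindVar (w : W) (t : W → Term α n) : W → Term α (n + 1) :=
  Function.update (fun x => Sum.map id Fin.castSucc (t x)) w (Sum.inr (Fin.last n))

theorem instTerm_castSucc (y : α) (x : Term α (n + 1)) :
    instTerm y (Sum.map id Fin.castSucc x) = Sum.map id Fin.castSucc (instTerm y x) := by
  rcases x with x | i
  · rfl
  · refine Fin.cases ?_ (fun i => ?_) i <;> rfl

theorem instTerm_bindVar (y : α) (w : W) (t : W → Term α (n + 1)) :
    (fun x => instTerm y (bindVar w t x)) = bindVar w (fun x => instTerm y (t x)) := by
  classical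
  funext x
  by_cases hx : x = w
  · subst hx
    simp only [bindVar, Function.update_self]
    rfl
  · simp only [bindVar, Function.update_of_ne hx, instTerm_castSucc]

open Classical in
theorem instTerm_bindVar_inl (y : α) (w : W) (s : W → α) :
    (fun x => instTerm y (bindVar w (fun x => (Sum.inl (s x) : Term α 0)) x)) =
      fun x => Sum.inl (Function.update s w y x) := by
  funext x
  by_cases hx : x = w
  · subst hx
    simp only [bindVar, Function.update_self]
    rfl
  · simp only [bindVar, Function.update_of_ne hx]
    rfl

theorem map_bindVar (h : α → β) (w : W) (t : W → Term α n) :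
    (fun x => Sum.map h id (bindVar w t x)) = bindVar w (fun x => Sum.map h id (t x)) := by
  funext x
  by_cases hx : x = w
  · subst hx
    simp [bindVar]
  · simp [bindVar, hx]

end Terms

theorem inst_atom {α : Type w} {n : ℕ} (y : α) (p : PredSymbol)
    (args : Fin p.arity → Term α (n + 1)) :
    (PreFormula.atom p args).inst y = .atom p fun i => instTerm y (args i) := by
  rw [PreFormula.inst]
  rfl

/-- The terms enter `B` as variables: instantiation acts on the terms only, and `B` has no free
variables besides the terms. -/
structure Schema.Natural {W : Type} {α : Type w} (B : Schema W α) : Prop where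
  inst : ∀ n (t : W → Term α (n + 1)) y, (B (n + 1) t).inst y = B n fun x => instTerm y (t x)
  free : ∀ n (t : W → Term α n) y, (B n t).FreeIn y → ∃ x, t x = Sum.inl y

/-- The existential quantification of a schema over the variables in a list. -/
noncomputable def exs {W : Type} {α : Type w} (B : Schema W α) : List W → Schema W α
  | [], n, t => B n t
  | w :: ws, n, t => .ex (exs B ws (n + 1) (bindVar w t))

/-- The universal quantification of a schema over the variables in a list. -/
noncomputable def alls {W : Type} {α : Type w} (B : Schema W α) : List W → Schema W α
  | [], n, t => B n t
  | w :: ws, n, t => .all (alls B ws (n + 1) (bindVar w t))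

section Quantifiers

variable {α : Type w} {β : Type v} {W : Type}

theorem bindVar_eq_inl {n : ℕ} {w x : W} {t : W → Term α n} {y : α}
    (h : bindVar w t x = Sum.inl y) : x ≠ w ∧ t x = Sum.inl y := by
  classical
  by_cases hx : x = w
  · subst hx
    simp [bindVar] at h
  · refine ⟨hx, ?_⟩
    simp only [bindVar, Function.update_of_ne hx] at h
    generalize t x = z at h
    rcases z with z | z
    · simpa using h
    · simp at h

theorem Schema.Natural.exs {B : Schema W α} (hB : B.Natural) (ws : List W) :
    (exs B ws).Natural := by
  induction ws with
  | nil => exact hB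
  | cons w ws ih =>
    constructor
    · intro n t y
      rw [HG.exs, HG.exs, PreFormula.inst, ih.inst, instTerm_bindVar]
    · intro n t y h
      obtain ⟨x, hx⟩ := ih.free _ _ _ h
      exact ⟨x, (bindVar_eq_inl hx).2⟩

theorem Schema.Natural.alls {B : Schema W α} (hB : B.Natural) (ws : List W) :
    (alls B ws).Natural := by
  induction ws with
  | nil => exact hB
  | cons w ws ih =>
    constructor
    · intro n t y
      rw [HG.alls, HG.alls, PreFormula.inst, ih.inst, instTerm_bindVar]
    · intro n t y h
      obtain ⟨x, hx⟩ := ih.free _ _ _ h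
      exact ⟨x, (bindVar_eq_inl hx).2⟩

theorem subst_exs {B : Schema W α} {B' : Schema W β} {h : α → β}
    (hB : ∀ n t, (B n t).subst h = B' n fun x => Sum.map h id (t x)) (ws : List W) (n : ℕ)
    (t : W → Term α n) : (exs B ws n t).subst h = exs B' ws n fun x => Sum.map h id (t x) := by
  induction ws generalizing n with
  | nil => exact hB n t
  | cons w ws ih =>
    change PreFormula.ex _ = PreFormula.ex _
    rw [ih, map_bindVar]

theorem subst_alls {B : Schema W α} {B' : Schema W β} {h : α → β}
    (hB : ∀ n t, (B n t).subst h = B' n fun x => Sum.map h id (t x)) (ws : List W) (n : ℕ)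
    (t : W → Term α n) : (alls B ws n t).subst h = alls B' ws n fun x => Sum.map h id (t x) := by
  induction ws generalizing n with
  | nil => exact hB n t
  | cons w ws ih =>
    change PreFormula.all _ = PreFormula.all _
    rw [ih, map_bindVar]

variable {B : Schema W Var} {ws : List W} {s s' : W → Var} {Γ : Multiset (Formula Var)}
  {C : Formula Var}

theorem Derivable.exs_right (hB : B.Natural) (hs : ∀ w ∉ ws, s' w = s w)
    (h : Derivable Γ (B 0 fun x => .inl (s' x))) :
    Derivable Γ (exs B ws 0 fun x => .inl (s x)) := by
  classical
  induction ws generalizing s with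
  | nil => rwa [show s = s' from funext fun w => (hs w (by simp)).symm]
  | cons w ws ih =>
    refine Derivable.exR (s' w) ?_
    rw [(hB.exs ws).inst, instTerm_bindVar_inl]
    refine ih fun x hx => ?_
    by_cases hxw : x = w
    · subst hxw
      simp
    · rw [Function.update_of_ne hxw]
      exact hs x (by simp [hx, hxw])

theorem Derivable.alls_left (hB : B.Natural) (hs : ∀ w ∉ ws, s' w = s w)
    (h : Derivable (B 0 (fun x => .inl (s' x)) ::ₘ Γ) C) :
    Derivable (alls B ws 0 (fun x => .inl (s x)) ::ₘ Γ) C := by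
  classical
  induction ws generalizing s with
  | nil => rwa [show s = s' from funext fun w => (hs w (by simp)).symm]
  | cons w ws ih =>
    refine Derivable.allL (s' w) ?_
    rw [(hB.alls ws).inst, instTerm_bindVar_inl]
    refine ih fun x hx => ?_
    by_cases hxw : x = w
    · subst hxw
      simp
    · rw [Function.update_of_ne hxw]
      exact hs x (by simp [hx, hxw])

/-- The values `s' w` for `w ∈ ws` serve as eigenvariables. They must also differ from the values
of `s`, including those that `s` assigns to elements of `ws` before these are bound. -/
theorem Derivable.exs_left (hB : B.Natural) (hws : ws.Nodup) (hs : ∀ w ∉ ws, s' w = s w)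
    (hne : ∀ w ∈ ws, ∀ x, s' w ≠ s x) (hinj : ∀ w ∈ ws, ∀ x ∈ ws, s' w = s' x → w = x)
    (hΓ : ∀ w ∈ ws, ∀ E ∈ Γ, ¬ E.FreeIn (s' w)) (hC : ∀ w ∈ ws, ¬ C.FreeIn (s' w))
    (h : Derivable (B 0 (fun x => .inl (s' x)) ::ₘ Γ) C) :
    Derivable (exs B ws 0 (fun x => .inl (s x)) ::ₘ Γ) C := by
  classical
  induction ws generalizing s with
  | nil => rwa [show s = s' from funext fun w => (hs w (by simp)).symm]
  | cons w ws ih =>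
    have hw : w ∈ w :: ws := List.mem_cons_self
    refine Derivable.exL (s' w) (hΓ w hw) ?_ (hC w hw) ?_
    · intro hf
      obtain ⟨x, hx⟩ := (hB.exs ws).free _ _ _ hf
      exact hne w hw x (Sum.inl.inj (bindVar_eq_inl hx).2).symm
    rw [(hB.exs ws).inst, instTerm_bindVar_inl]
    rw [List.nodup_cons] at hws
    refine ih hws.2 ?_ ?_ ?_ ?_ ?_
    · intro x hx
      by_cases hxw : x = w
      · subst hxw
        simp
      · rw [Function.update_of_ne hxw]
        exact hs x (by simp [hx, hxw])
    · intro x hx z hxz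
      have hx' := List.mem_cons_of_mem w hx
      by_cases hzw : z = w
      · subst hzw
        rw [Function.update_self] at hxz
        exact hws.1 (hinj x hx' z hw hxz ▸ hx)
      · rw [Function.update_of_ne hzw] at hxz
        exact hne x hx' z hxz
    · exact fun x hx z hz =>
        hinj x (List.mem_cons_of_mem w hx) z (List.mem_cons_of_mem w hz)
    · exact fun x hx => hΓ x (List.mem_cons_of_mem w hx)
    · exact fun x hx => hC x (List.mem_cons_of_mem w hx)

end Quantifiers

/-! ### Tensor products -/

/-- The tensor product of `A` and of the formulae in a list. -/
def tensors {α : Type w} {n : ℕ} (A : PreFormula α n) (l : List (PreFormula α n)) :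
    PreFormula α n :=
  l.foldr PreFormula.tensor A

theorem subst_tensors {α : Type w} {β : Type v} (h : α → β) {n : ℕ} (A : PreFormula α n)
    (l : List (PreFormula α n)) :
    (tensors A l).subst h = tensors (A.subst h) (l.map (PreFormula.subst h)) := by
  induction l with
  | nil => rfl
  | cons B l ih => exact congrArg (PreFormula.tensor (B.subst h)) ih

theorem inst_tensors {α : Type w} (y : α) {n : ℕ} (A : PreFormula α (n + 1))
    (l : List (PreFormula α (n + 1))) :
    (tensors A l).inst y = tensors (A.inst y) (l.map (PreFormula.inst y)) := by
  induction l with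
  | nil => rfl
  | cons B l ih =>
    change (PreFormula.tensor B (tensors A l)).inst y = _
    rw [PreFormula.inst, ih]
    rfl

theorem freeIn_tensors {α : Type w} {y : α} {n : ℕ} {A : PreFormula α n}
    {l : List (PreFormula α n)} :
    (tensors A l).FreeIn y ↔ A.FreeIn y ∨ ∃ B ∈ l, B.FreeIn y := by
  induction l with
  | nil => simp [tensors]
  | cons B l ih =>
    change B.FreeIn y ∨ (tensors A l).FreeIn y ↔ _
    rw [ih]
    simp only [List.mem_cons, exists_eq_or_imp]
    tauto

theorem Derivable.tensors_right (A : Formula Var) (l : List (Formula Var)) :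
    Derivable (A ::ₘ (l : Multiset (Formula Var))) (tensors A l) := by
  induction l with
  | nil => exact Derivable.ax A
  | cons B l ih =>
    have := Derivable.tensorR (Derivable.ax B) ih
    rw [Multiset.singleton_add, Multiset.cons_swap] at this
    exact this

theorem Derivable.tensors_left {A : Formula Var} {l : List (Formula Var)}
    {Γ : Multiset (Formula Var)} {C : Formula Var}
    (h : Derivable (A ::ₘ ((l : Multiset (Formula Var)) + Γ)) C) :
    Derivable (tensors A l ::ₘ Γ) C := by
  induction l generalizing Γ with
  | nil => simpa [tensors] using h
  | cons B l ih =>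
    refine Derivable.tensorL ?_
    rw [Multiset.cons_swap]
    refine ih ?_
    rwa [Multiset.add_cons, ← Multiset.cons_add]

/-- A family of tensor products on the left-hand side can be decomposed. -/
theorem Derivable.map_tensors_left {I : Multiset (Formula Var × List (Formula Var))}
    {Γ : Multiset (Formula Var)} {C : Formula Var}
    (h : Derivable (I.map Prod.fst + I.bind (fun p => (p.2 : Multiset (Formula Var))) + Γ) C) :
    Derivable (I.map (fun p => tensors p.1 p.2) + Γ) C := by
  induction I using Multiset.induction_on generalizing Γ with
  | empty => simpa using h
  | cons p I ih =>
    rw [Multiset.map_cons, Multiset.cons_add]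
    refine Derivable.tensors_left ?_
    have : p.1 ::ₘ ((p.2 : Multiset (Formula Var)) + (I.map (fun p => tensors p.1 p.2) + Γ)) =
        I.map (fun p => tensors p.1 p.2) + (p.1 ::ₘ ((p.2 : Multiset (Formula Var)) + Γ)) := by
      simp only [← Multiset.singleton_add]
      abel
    rw [this]
    refine ih ?_
    convert h using 1
    rw [Multiset.map_cons, Multiset.cons_bind]
    simp only [← Multiset.singleton_add]
    abel

/-! ### Hypergraphs as formulae -/

section Diagram

/-- A nullary atom. It plays the role of the unit of the tensor product, which is not available
in MILL1; with it, the empty hypergraph can be expressed as well. -/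
def token {α : Type w} {n : ℕ} : PreFormula α n := .atom ⟨0, 0⟩ Fin.elim0

theorem subst_token {α β : Type*} (h : α → β) {n : ℕ} :
    (token : PreFormula α n).subst h = token :=
  congrArg _ (funext fun i => i.elim0)

/-- The atom that states that `x` is a node. -/
def nodeAtom {α : Type w} {n : ℕ} (x : Term α n) : PreFormula α n := .atom ⟨0, 1⟩ fun _ => x

/-- The atom that states that there is a hyperedge with the label `a` and the attachment nodes
`t`. The predicate symbol that corresponds to `a` has the index `code a + 1`, as the index `0` is
used by `token` and `nodeAtom`. -/
noncomputable def linkAtom {α : Type w} {n : ℕ} (code : A.Symbol → ℕ) (a : A.Symbol)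
    (t : A.type a → Term α n) : PreFormula α n :=
  .atom ⟨code a + 1, Nat.card (A.type a)⟩ fun i => t ((Finite.equivFin _).symm i)

variable (code : A.Symbol → ℕ)

/-- The tensor product of the atoms that describe the nodes and hyperedges of `H`. -/
noncomputable def diagram {α : Type w} (H : Hypergraph A) : Schema H.V α := fun _ t =>
  tensors token ((enum H.V).map (fun x => nodeAtom (t x)) ++
    (enum H.E).map fun e => linkAtom code (H.lab e) fun σ => t (H.att e σ))

theorem subst_diagram {α β : Type*} (H : Hypergraph A) (h : α → β) {n : ℕ}
    (t : H.V → Term α n) :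
    (diagram code H n t).subst h = diagram code H n fun x => Sum.map h id (t x) := by
  simp only [diagram, subst_tensors, List.map_append, List.map_map]
  rw [subst_token]
  rfl

theorem diagram_natural {α : Type w} (H : Hypergraph A) :
    (diagram (α := α) code H).Natural := by
  constructor
  · intro n t y
    simp only [diagram, inst_tensors, List.map_append, List.map_map]
    congr 1
    · refine (inst_atom _ _ _).trans ?_
      exact congrArg _ (funext fun i => i.elim0)
    · congr 2 <;> funext x <;> exact inst_atom _ _ _
  · intro n t y h
    rcases freeIn_tensors.1 h with ⟨i, -⟩ | ⟨B, hB, hy⟩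
    · exact i.elim0
    · rcases List.mem_append.1 hB with hB | hB
      · obtain ⟨x, -, rfl⟩ := List.mem_map.1 hB
        obtain ⟨i, hi⟩ := hy
        exact ⟨x, hi⟩
      · obtain ⟨e, -, rfl⟩ := List.mem_map.1 hB
        obtain ⟨i, hi⟩ := hy
        exact ⟨_, hi⟩

theorem Schema.Natural.comp {α : Type w} {V W : Type} {B : Schema V α} (hB : B.Natural)
    (g : V → W) : Schema.Natural (fun n (t : W → Term α n) => B n fun x => t (g x)) :=
  ⟨fun n _ y => hB.inst n _ y, fun n _ y h => (hB.free n _ y h).imp' g fun _ h => h⟩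

theorem Schema.Natural.lolli {α : Type w} {W : Type} {B C : Schema W α} (hB : B.Natural)
    (hC : C.Natural) : Schema.Natural (fun n t => .lolli (B n t) (C n t)) :=
  ⟨fun n t y => by rw [PreFormula.inst, hB.inst, hC.inst],
    fun n t y h => h.elim (hB.free n t y) (hC.free n t y)⟩

/-- The atoms that describe a configuration. -/
noncomputable def atoms (c : Config A Var) : Multiset (Formula Var) :=
  c.1.map (fun x => nodeAtom (.inl x)) + c.2.map fun l => linkAtom code l.1 fun σ => .inl (l.2 σ)

theorem atoms_add (c c' : Config A Var) : atoms code (c + c') = atoms code c + atoms code c' := by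
  simp only [atoms, Prod.fst_add, Prod.snd_add, Multiset.map_add]
  abel

theorem coe_diagram_atoms (H : Hypergraph A) (s : H.V → Var) :
    (((enum H.V).map (fun x => nodeAtom (.inl (s x))) ++
      (enum H.E).map fun e => linkAtom code (H.lab e) fun σ => .inl (s (H.att e σ)) :
      List (Formula Var)) : Multiset (Formula Var)) = atoms code (H.config s) := by
  rw [← Multiset.coe_add, coe_map_enum, coe_map_enum, atoms, Hypergraph.config, map_family,
    map_family]
  rfl

variable {code}

theorem Derivable.diagram_right (H : Hypergraph A) (s : H.V → Var) :
    Derivable (token ::ₘ atoms code (H.config s)) (diagram code H 0 fun x => .inl (s x)) := by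
  rw [← coe_diagram_atoms]
  exact Derivable.tensors_right _ _

theorem Derivable.diagram_left {H : Hypergraph A} {s : H.V → Var} {Γ : Multiset (Formula Var)}
    {C : Formula Var} (h : Derivable (token ::ₘ (atoms code (H.config s) + Γ)) C) :
    Derivable (diagram code H 0 (fun x => .inl (s x)) ::ₘ Γ) C := by
  rw [← coe_diagram_atoms] at h
  exact Derivable.tensors_left h

theorem exists_of_freeIn_atoms {H : Hypergraph A} {c : Config A Var} {f : H.V → Var}
    (hc : c ≤ H.config f) {E : Formula Var} (hE : E ∈ atoms code c) {z : Var}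
    (hz : E.FreeIn z) : ∃ x, f x = z := by
  rcases Multiset.mem_add.1 hE with hE | hE
  · obtain ⟨x, hx, rfl⟩ := Multiset.mem_map.1 hE
    obtain ⟨i, hi⟩ := hz
    obtain ⟨v, rfl⟩ := mem_family.1 (Multiset.mem_of_le hc.1 hx)
    exact ⟨v, Sum.inl.inj hi⟩
  · obtain ⟨l, hl, rfl⟩ := Multiset.mem_map.1 hE
    obtain ⟨i, hi⟩ := hz
    obtain ⟨e, rfl⟩ := mem_family.1 (Multiset.mem_of_le hc.2 hl)
    exact ⟨_, Sum.inl.inj hi⟩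

end Diagram

/-! ### Rules as formulae -/

section Rule

variable (code : A.Symbol → ℕ) (r : HTRule A)

open Classical in
/-- The nodes of the two sides of a rule, where the external nodes of the left-hand side are
identified with those of the right-hand side. -/
noncomputable def HTRule.glue (v : r.lhs.V) : r.rhs.V ⊕ r.lhs.V :=
  if hv : v ∈ Set.range r.lhs.ext then
    .inl (r.rhs.ext ⟨hv.choose.1, r.type_eq.subset hv.choose.2⟩)
  else .inr v

theorem HTRule.glue_ext (σ : Sel) (h : σ ∈ r.lhs.type) (h' : σ ∈ r.rhs.type) :
    r.glue (r.lhs.ext ⟨σ, h⟩) = .inl (r.rhs.ext ⟨σ, h'⟩) := by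
  have hv : r.lhs.ext ⟨σ, h⟩ ∈ Set.range r.lhs.ext := ⟨_, rfl⟩
  rw [HTRule.glue, dif_pos hv]
  have hc : (hv.choose : Sel) = σ := congrArg Subtype.val (r.lhs_injective hv.choose_spec)
  congr 2
  exact Subtype.ext hc

theorem HTRule.glue_of_notMem {v : r.lhs.V} (hv : v ∉ Set.range r.lhs.ext) :
    r.glue v = .inr v := dif_neg hv

theorem HTRule.glue_injective : Function.Injective r.glue := by
  intro v w h
  by_cases hv : v ∈ Set.range r.lhs.ext <;> by_cases hw : w ∈ Set.range r.lhs.ext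
  · obtain ⟨⟨σ, hσ⟩, rfl⟩ := hv
    obtain ⟨⟨τ, hτ⟩, rfl⟩ := hw
    rw [r.glue_ext σ hσ (r.type_eq.subset hσ), r.glue_ext τ hτ (r.type_eq.subset hτ)] at h
    have hστ : σ = τ := congrArg Subtype.val (r.rhs_injective (Sum.inl.inj h))
    subst hστ
    rfl
  · obtain ⟨⟨σ, hσ⟩, rfl⟩ := hv
    rw [r.glue_ext σ hσ (r.type_eq.subset hσ), r.glue_of_notMem hw] at h
    cases h
  · obtain ⟨⟨τ, hτ⟩, rfl⟩ := hw
    rw [r.glue_of_notMem hv, r.glue_ext τ hτ (r.type_eq.subset hτ)] at h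
    cases h
  · rw [r.glue_of_notMem hv, r.glue_of_notMem hw] at h
    exact Sum.inr.inj h

/-- The list of the internal nodes of a hypergraph. -/
noncomputable def Hypergraph.internal (H : Hypergraph A) : List H.V :=
  (enum {v // v ∉ Set.range H.ext}).map Subtype.val

theorem Hypergraph.mem_internal {H : Hypergraph A} {v : H.V} :
    v ∈ H.internal ↔ v ∉ Set.range H.ext := by
  simp [Hypergraph.internal, mem_enum]

theorem Hypergraph.nodup_internal (H : Hypergraph A) : H.internal.Nodup :=
  (nodup_enum _).map Subtype.val_injective

/-- The left-hand side of a rule, as a formula; its internal nodes are bound. -/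
noncomputable def lhsSchema {α : Type w} : Schema (r.rhs.V ⊕ r.lhs.V) α :=
  exs (fun n t => diagram code r.lhs n fun x => t (r.glue x)) (r.lhs.internal.map .inr)

/-- The right-hand side of a rule implies its left-hand side. -/
noncomputable def ruleSchema {α : Type w} : Schema (r.rhs.V ⊕ r.lhs.V) α := fun n t =>
  .lolli (diagram code r.rhs n fun x => t (.inl x)) (lhsSchema code r n t)

/-- The closed formula that allows for one application of a rule, from right to left. The variable
bound by the outermost quantifier does not matter; it is a value for the nodes that are not yet
bound to variables. -/
noncomputable def ruleFormula {α : Type w} : Formula α :=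
  .all (alls (ruleSchema code r) ((enum r.rhs.V).map .inl) 1 fun _ => .inr 0)

theorem lhsSchema_natural {α : Type w} : (lhsSchema (α := α) code r).Natural :=
  ((diagram_natural code r.lhs).comp r.glue).exs _

theorem ruleSchema_natural {α : Type w} : (ruleSchema (α := α) code r).Natural :=
  ((diagram_natural code r.rhs).comp .inl).lolli (lhsSchema_natural code r)

theorem subst_ruleFormula {α β : Type*} (h : α → β) :
    (ruleFormula code r).subst h = ruleFormula code r := by
  change PreFormula.all _ = PreFormula.all _
  rw [subst_alls (B' := ruleSchema code r)]
  · rfl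
  · intro n t
    change PreFormula.lolli _ _ = PreFormula.lolli _ _
    rw [subst_diagram, lhsSchema, subst_exs]
    · rfl
    · intro n t
      rw [subst_diagram]

theorem not_freeIn_ruleFormula {α : Type w} (y : α) : ¬ (ruleFormula code r).FreeIn y := by
  intro h
  obtain ⟨x, hx⟩ := ((ruleSchema_natural code r).alls _).free _ _ _ h
  cases hx

variable {code r}

/-- The formula of a rule replaces a copy of the right-hand side by a copy of the left-hand side
whose internal nodes are new variables. -/
theorem Derivable.ruleFormula_left {s : r.lhs.V → Var} {s' : r.rhs.V → Var}
    {Γ : Multiset (Formula Var)} {C : Formula Var}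
    (hs : ∀ σ h h', s (r.lhs.ext ⟨σ, h⟩) = s' (r.rhs.ext ⟨σ, h'⟩))
    (h0 : ∀ v ∉ Set.range r.lhs.ext, s v ≠ 0)
    (hinj : ∀ v ∉ Set.range r.lhs.ext, ∀ w ∉ Set.range r.lhs.ext, s v = s w → v = w)
    (hs' : ∀ v ∉ Set.range r.lhs.ext, ∀ x, s v ≠ s' x)
    (hΓ : ∀ v ∉ Set.range r.lhs.ext, ∀ E ∈ Γ, ¬ E.FreeIn (s v))
    (hC : ∀ v ∉ Set.range r.lhs.ext, ¬ C.FreeIn (s v))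
    (h : Derivable (token ::ₘ (atoms code (r.lhs.config s) + Γ)) C) :
    Derivable (ruleFormula code r ::ₘ (token ::ₘ atoms code (r.rhs.config s') + Γ)) C := by
  classical
  -- The outermost variable is instantiated by `0`. So all nodes are represented by `0` before they
  -- are bound, which is why the new variables must not be `0`.
  refine Derivable.allL 0 ?_
  rw [((ruleSchema_natural code r).alls _).inst]
  refine Derivable.alls_left (s := fun _ => 0) (s' := Sum.elim s' fun _ => 0)
    (ruleSchema_natural code r) ?_ ?_
  · rintro (x | x) hx
    · exact absurd (List.mem_map.2 ⟨x, mem_enum x, rfl⟩) hx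
    · rfl
  rw [add_comm]
  refine Derivable.lolliL (Derivable.diagram_right r.rhs s') ?_
  have hmem : ∀ w ∈ r.lhs.internal.map (Sum.inr (α := r.rhs.V)),
      ∃ v ∉ Set.range r.lhs.ext, Sum.inr v = w := by
    intro w hw
    obtain ⟨v, hv, rfl⟩ := List.mem_map.1 hw
    exact ⟨v, Hypergraph.mem_internal.1 hv, rfl⟩
  let s'' : r.rhs.V ⊕ r.lhs.V → Var :=
    Sum.elim s' fun v => if v ∈ Set.range r.lhs.ext then 0 else s v
  have hs'' : ∀ v ∉ Set.range r.lhs.ext, s'' (.inr v) = s v := fun v hv => if_neg hv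
  refine Derivable.exs_left (s' := s'') ((diagram_natural code r.lhs).comp r.glue)
    (r.lhs.nodup_internal.map Sum.inr_injective) ?_ ?_ ?_ ?_ ?_ ?_
  · rintro (x | v) hw
    · rfl
    · by_cases hv : v ∈ Set.range r.lhs.ext
      · exact if_pos hv
      · exact absurd (List.mem_map.2 ⟨v, Hypergraph.mem_internal.2 hv, rfl⟩) hw
  · intro w hw
    obtain ⟨v, hv, rfl⟩ := hmem w hw
    rw [hs'' v hv]
    rintro (x | x)
    · exact hs' v hv x
    · exact h0 v hv
  · intro w hw x hx
    obtain ⟨v, hv, rfl⟩ := hmem w hw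
    obtain ⟨v', hv', rfl⟩ := hmem x hx
    rw [hs'' v hv, hs'' v' hv']
    exact fun h => congrArg _ (hinj v hv v' hv' h)
  · intro w hw
    obtain ⟨v, hv, rfl⟩ := hmem w hw
    rw [hs'' v hv]
    exact hΓ v hv
  · intro w hw
    obtain ⟨v, hv, rfl⟩ := hmem w hw
    rw [hs'' v hv]
    exact hC v hv
  · have : (fun x => (Sum.inl (s'' (r.glue x)) : Term Var 0)) = fun x => .inl (s x) := by
      funext v
      by_cases hv : v ∈ Set.range r.lhs.ext
      · obtain ⟨⟨σ, hσ⟩, rfl⟩ := hv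
        rw [r.glue_ext σ hσ (r.type_eq.subset hσ)]
        exact congrArg _ (hs _ _ _).symm
      · rw [r.glue_of_notMem hv, hs'' v hv]
    rw [this]
    exact Derivable.diagram_left h

end Rule

/-! ### The goal formula -/

section Goal

variable (code : A.Symbol → ℕ) (S : Hypergraph A)

open Classical in
/-- The term that represents a node of `S` in `goalFormula`: external nodes are represented by
their selectors. -/
noncomputable def goalTerm (v : S.V) : Term S.type 1 :=
  if hv : v ∈ Set.range S.ext then .inl hv.choose else .inr 0

/-- The formula that describes the hypergraph `S` up to isomorphism; its free variables are the
external nodes. As in `ruleFormula`, the variable bound by the outermost quantifier does not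
matter. -/
noncomputable def goalFormula : Formula S.type :=
  .ex (exs (diagram code S) S.internal 1 (goalTerm S))

theorem subst_goalFormula {α : Type*} (h : S.type → α) :
    (goalFormula code S).subst h =
      .ex (exs (diagram code S) S.internal 1 fun v => Sum.map h id (goalTerm S v)) := by
  change PreFormula.ex _ = PreFormula.ex _
  rw [subst_exs (B' := diagram code S)]
  intro n t
  rw [subst_diagram]

theorem exists_of_freeIn_goalFormula {h : S.type → Var} {z : Var}
    (hz : ((goalFormula code S).subst h).FreeIn z) : ∃ σ, h σ = z := by
  rw [subst_goalFormula] at hz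
  obtain ⟨v, hv⟩ := ((diagram_natural code S).exs _).free _ _ _ hz
  generalize goalTerm S v = x at hv
  rcases x with σ | i
  · exact ⟨σ, Sum.inl.inj hv⟩
  · cases hv

variable {S}

theorem goalTerm_ext (hS : Function.Injective S.ext) (σ : S.type) :
    goalTerm S (S.ext σ) = .inl σ := by
  have hv : S.ext σ ∈ Set.range S.ext := ⟨_, rfl⟩
  rw [goalTerm, dif_pos hv]
  exact congrArg _ (hS hv.choose_spec)

variable {code}

theorem Derivable.goalFormula_right (hS : Function.Injective S.ext) {h : S.type → Var}
    {s : S.V → Var} (hs : ∀ σ, s (S.ext σ) = h σ) :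
    Derivable (token ::ₘ atoms code (S.config s)) ((goalFormula code S).subst h) := by
  classical
  rw [subst_goalFormula]
  refine Derivable.exR 0 ?_
  rw [((diagram_natural code S).exs _).inst]
  have : (fun x => instTerm 0 (Sum.map h id (goalTerm S x))) =
      fun x => (.inl (if x ∈ Set.range S.ext then s x else 0) : Term Var 0) := by
    funext v
    by_cases hv : v ∈ Set.range S.ext
    · rw [if_pos hv]
      obtain ⟨σ, rfl⟩ := hv
      rw [goalTerm_ext hS, hs]
      rfl
    · rw [if_neg hv, goalTerm, dif_neg hv]
      rfl
  rw [this]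
  refine Derivable.exs_right (s' := s) (diagram_natural code S) ?_
    (Derivable.diagram_right S s)
  intro v hv
  have : v ∈ Set.range S.ext := by
    by_contra h
    exact hv (Hypergraph.mem_internal.2 h)
  exact (if_pos this).symm

end Goal

/-! ### Phase semantics -/

section Phase

open scoped Pointwise

variable {M : Type w} [AddCommMonoid M] (P : Set M)

/-- The closure operator of phase semantics: the set of all `m` such that every context `k` with
`k + x ∈ P` for all `x ∈ X` satisfies `k + m ∈ P`. -/
def phaseClosure (X : Set M) : Set M := {m | ∀ k, (∀ x ∈ X, k + x ∈ P) → k + m ∈ P}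

/-- The interpretation of formulae in the phase space `(M, P)`, where `I` interprets the atoms.
The valuations `v` and `w` take care of the free and of the bound variables; the individuals are
the logical variables themselves. -/
def sem (I : (p : PredSymbol) → (Fin p.arity → Var) → Set M) {α : Type u} :
    {n : ℕ} → PreFormula α n → (α → Var) → (Fin n → Var) → Set M
  | _, .atom p args, v, w => phaseClosure P (I p fun i => Sum.elim v w (args i))
  | _, .tensor A B, v, w => phaseClosure P (sem I A v w + sem I B v w)
  | _, .lolli A B, v, w => {m | ∀ x ∈ sem I A v w, m + x ∈ sem I B v w}
  | _, .ex A, v, w => phaseClosure P (⋃ d, sem I A v (Fin.snoc w d))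
  | _, .all A, v, w => ⋂ d, sem I A v (Fin.snoc w d)

variable {P}

theorem subset_phaseClosure (X : Set M) : X ⊆ phaseClosure P X := fun x hx _ hk => hk x hx

theorem phaseClosure_idem (X : Set M) :
    phaseClosure P (phaseClosure P X) ⊆ phaseClosure P X :=
  fun _ hm k hk => hm k fun _ hx => hx k hk

theorem forall_mem_phaseClosure {X : Set M} {k : M} :
    (∀ x ∈ phaseClosure P X, k + x ∈ P) ↔ ∀ x ∈ X, k + x ∈ P :=
  ⟨fun h x hx => h x (subset_phaseClosure X hx), fun h _ hx => hx k h⟩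

theorem phaseClosure_subset {X Y : Set M} (h : X ⊆ Y) (hY : phaseClosure P Y ⊆ Y) :
    phaseClosure P X ⊆ Y :=
  fun _ hm => hY fun k hk => hm k fun x hx => hk x (h hx)

theorem phaseClosure_add_subset {X Y Z : Set M} (h : X + Z ⊆ Y) (hY : phaseClosure P Y ⊆ Y) :
    phaseClosure P X + Z ⊆ Y := by
  rintro _ ⟨m, hm, z, hz, rfl⟩
  refine hY fun k hk => ?_
  have := hm (k + z) fun x hx => by
    rw [add_assoc, add_comm z]
    exact hk _ (h ⟨x, hx, z, hz, rfl⟩)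
  rwa [add_assoc, add_comm z] at this

theorem phaseClosure_add_singleton (a b : M) :
    phaseClosure P (phaseClosure P {a} + phaseClosure P {b}) = phaseClosure P {a + b} := by
  apply subset_antisymm
  · refine phaseClosure_subset (phaseClosure_add_subset ?_ (phaseClosure_idem _))
      (phaseClosure_idem _)
    rw [add_comm]
    refine phaseClosure_add_subset ?_ (phaseClosure_idem _)
    rw [Set.singleton_add_singleton, add_comm]
    exact subset_phaseClosure _
  · refine fun m hm k hk => hm k fun x hx => hk x ?_
    rw [Set.mem_singleton_iff.1 hx]
    exact ⟨a, subset_phaseClosure _ rfl, b, subset_phaseClosure _ rfl, rfl⟩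

variable {I : (p : PredSymbol) → (Fin p.arity → Var) → Set M}

theorem sem_closed {α : Type u} {n : ℕ} (A : PreFormula α n) (v : α → Var) (w : Fin n → Var) :
    phaseClosure P (sem P I A v w) ⊆ sem P I A v w := by
  induction A with
  | atom p args => exact phaseClosure_idem _
  | tensor A B => exact phaseClosure_idem _
  | lolli A B _ ihB =>
    intro m hm x hx
    refine ihB w fun k hk => ?_
    have := hm (k + x) fun y hy => by
      rw [add_assoc, add_comm x]
      exact hk _ (hy x hx)
    rwa [add_assoc, add_comm x] at this
  | ex A => exact phaseClosure_idem _
  | all A ih =>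
    intro m hm
    refine Set.mem_iInter.2 fun d => ih _ fun k hk => hm k fun x hx => hk x ?_
    exact Set.mem_iInter.1 hx d

theorem sem_subst {α : Type u} {β : Type v} (h : α → β) {n : ℕ} (A : PreFormula α n)
    (v : β → Var) (w : Fin n → Var) :
    sem P I (A.subst h) v w = sem P I A (fun x => v (h x)) w := by
  induction A with
  | atom p args =>
    simp only [PreFormula.subst, sem]
    congr 2
    funext i
    rcases args i with x | x <;> rfl
  | tensor A B ihA ihB => simp only [PreFormula.subst, sem, ihA, ihB]
  | lolli A B ihA ihB => simp only [PreFormula.subst, sem, ihA, ihB]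
  | ex A ih => simp only [PreFormula.subst, sem, ih]
  | all A ih => simp only [PreFormula.subst, sem, ih]

theorem sem_inst {α : Type u} (y : α) (v : α → Var) : {n : ℕ} → (A : PreFormula α (n + 1)) →
    (w : Fin n → Var) → sem P I (A.inst y) v w = sem P I A v (Fin.cons (v y) w)
  | _, .atom p args, w => by
    rw [PreFormula.inst]
    simp only [sem]
    congr 2
    funext i
    rcases args i with x | x
    · rfl
    · refine Fin.cases ?_ (fun x => ?_) x <;> rfl
  | _, .tensor A B, w => by
    rw [PreFormula.inst]
    simp only [sem, sem_inst y v A w, sem_inst y v B w]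
  | _, .lolli A B, w => by
    rw [PreFormula.inst]
    simp only [sem, sem_inst y v A w, sem_inst y v B w]
  | _, .ex A, w => by
    rw [PreFormula.inst]
    simp only [sem, sem_inst y v A, Fin.cons_snoc_eq_snoc_cons]
  | _, .all A, w => by
    rw [PreFormula.inst]
    simp only [sem, sem_inst y v A, Fin.cons_snoc_eq_snoc_cons]

theorem sem_congr {α : Type u} {v v' : α → Var} {n : ℕ} (A : PreFormula α n)
    (h : ∀ x, A.FreeIn x → v x = v' x) (w : Fin n → Var) :
    sem P I A v w = sem P I A v' w := by
  induction A with
  | atom p args =>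
    simp only [sem]
    congr 2
    funext i
    rcases hx : args i with x | x
    · exact h x ⟨i, hx⟩
    · rfl
  | tensor A B ihA ihB =>
    simp only [sem, ihA fun x hx => h x (Or.inl hx), ihB fun x hx => h x (Or.inr hx)]
  | lolli A B ihA ihB =>
    simp only [sem, ihA fun x hx => h x (Or.inl hx), ihB fun x hx => h x (Or.inr hx)]
  | ex A ih => simp only [sem, ih h]
  | all A ih => simp only [sem, ih h]

/-- Soundness of MILL1 for phase semantics. -/
theorem Derivable.sem_subset {Γ : Multiset (Formula Var)} {C : Formula Var} (h : Derivable Γ C)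
    (v : Var → Var) :
    (Γ.map fun A => sem P I A v Fin.elim0).sum ⊆ sem P I C v Fin.elim0 := by
  have hsnoc : ∀ d : Var, (Fin.snoc Fin.elim0 d : Fin 1 → Var) = Fin.cons d Fin.elim0 := by
    intro d
    funext i
    rw [Fin.eq_zero i]
    rfl
  have hup : ∀ (v : Var → Var) (z d : Var) (A : Formula Var), ¬ A.FreeIn z →
      sem P I A (Function.update v z d) Fin.elim0 = sem P I A v Fin.elim0 := by
    intro v z d A hA
    refine sem_congr A (fun x hx => Function.update_of_ne ?_ _ _) _
    rintro rfl
    exact hA hx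
  have hinst : ∀ (v : Var → Var) (z d : Var) (A : PreFormula Var 1), ¬ A.FreeIn z →
      sem P I (A.inst z) (Function.update v z d) Fin.elim0 =
        sem P I A v (Fin.snoc Fin.elim0 d) := by
    intro v z d A hA
    rw [sem_inst, Function.update_self, hsnoc]
    refine sem_congr A (fun x hx => Function.update_of_ne ?_ _ _) _
    rintro rfl
    exact hA hx
  have hΓ : ∀ (v : Var → Var) (z d : Var) (Γ : Multiset (Formula Var)), (∀ E ∈ Γ, ¬ E.FreeIn z) →
      (Γ.map fun A => sem P I A (Function.update v z d) Fin.elim0) =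
        Γ.map fun A => sem P I A v Fin.elim0 :=
    fun v z d Γ h => Multiset.map_congr rfl fun E hE => hup v z d E (h E hE)
  induction h generalizing v with
  | ax A => simp
  | tensorL _ ih =>
    have ih := ih v
    simp only [Multiset.map_cons, Multiset.sum_cons, ← add_assoc] at ih ⊢
    exact phaseClosure_add_subset ih (sem_closed _ _ _)
  | tensorR _ _ ih1 ih2 =>
    rw [Multiset.map_add, Multiset.sum_add]
    exact (Set.add_subset_add (ih1 v) (ih2 v)).trans
      (subset_phaseClosure _)
  | lolliL _ _ ih1 ih2 =>
    have ih1 := ih1 v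
    have ih2 := ih2 v
    simp only [Multiset.map_cons, Multiset.sum_cons, Multiset.map_add, Multiset.sum_add] at ih2 ⊢
    rintro _ ⟨m, hm, _, ⟨g, hg, x, hx, rfl⟩, rfl⟩
    refine ih2 ⟨m + x, hm x (ih1 hx), g, hg, ?_⟩
    change m + x + g = m + (g + x)
    abel
  | lolliR _ ih =>
    have ih := ih v
    simp only [Multiset.map_cons, Multiset.sum_cons] at ih
    exact fun m hm x hx => ih ⟨x, hx, m, hm, add_comm _ _⟩
  | exL z h1 h2 h3 _ ih =>
    simp only [Multiset.map_cons, Multiset.sum_cons] at ih ⊢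
    refine phaseClosure_add_subset ?_ (sem_closed _ _ _)
    rintro _ ⟨m, hm, g, hg, rfl⟩
    obtain ⟨d, hd⟩ := Set.mem_iUnion.1 hm
    -- The eigenvariable does not occur elsewhere, so that it may be given the value `d`.
    have ih := ih (Function.update v z d)
    rw [hinst v z d _ h2, hΓ v z d _ h1, hup v z d _ h3] at ih
    exact ih ⟨m, hd, g, hg, rfl⟩
  | exR y _ ih =>
    refine (ih v).trans (subset_trans ?_ (subset_phaseClosure _))
    rw [sem_inst, ← hsnoc]
    exact Set.subset_iUnion (fun d => sem P I _ v (Fin.snoc Fin.elim0 d)) (v y)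
  | allL y _ ih =>
    have ih := ih v
    simp only [Multiset.map_cons, Multiset.sum_cons] at ih ⊢
    refine subset_trans (Set.add_subset_add_right ?_) ih
    rw [sem_inst, ← hsnoc]
    exact Set.iInter_subset (fun d => sem P I _ v (Fin.snoc Fin.elim0 d)) (v y)
  | allR z h1 h2 _ ih =>
    refine Set.subset_iInter fun d => ?_
    have ih := ih (Function.update v z d)
    rwa [hinst v z d _ h2, hΓ v z d _ h1] at ih

open Classical in
/-- The value `d` of the new innermost bound variable becomes the value of the variable `a` of a
schema. -/
theorem elim_snoc_bindVar {α : Type u} {W : Type} {n : ℕ} (v : α → Var) (w : Fin n → Var) (d : Var)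
    (a : W) (t : W → Term α n) (y : W) :
    Sum.elim v (Fin.snoc w d : Fin (n + 1) → Var) (bindVar a t y) =
      Function.update (fun x => Sum.elim v w (t x)) a d y := by
  by_cases hya : y = a
  · subst hya
    simp [bindVar]
  · simp only [bindVar, Function.update_of_ne hya]
    rcases t y with x | x
    · rfl
    · simp

/-- If a schema is interpreted by `b`, then a context fits all elements of its existential
quantification if and only if it fits all elements of all instances. -/
theorem forall_mem_sem_exs {α : Type u} {W : Type} {B : Schema W α} {v : α → Var}
    {b : (W → Var) → Set M}
    (hB : ∀ n (t : W → Term α n) w, sem P I (B n t) v w = b fun x => Sum.elim v w (t x))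
    (ws : List W) (n : ℕ) (t : W → Term α n) (w : Fin n → Var) (k : M) :
    (∀ x ∈ sem P I (exs B ws n t) v w, k + x ∈ P) ↔
      ∀ s : W → Var, (∀ y ∉ ws, s y = Sum.elim v w (t y)) → ∀ x ∈ b s, k + x ∈ P := by
  classical
  induction ws generalizing n with
  | nil =>
    rw [exs, hB]
    exact ⟨fun h s hs => (funext fun y => hs y (by simp) : s = _) ▸ h, fun h => h _ fun _ _ => rfl⟩
  | cons a ws ih =>
    simp only [exs, sem, forall_mem_phaseClosure, Set.mem_iUnion, forall_exists_index]
    rw [forall_comm]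
    simp only [ih, elim_snoc_bindVar]
    constructor
    · intro h s hs
      refine h (s a) s fun y hy => ?_
      by_cases hya : y = a
      · subst hya
        simp
      · rw [Function.update_of_ne hya]
        exact hs y (by simp [hy, hya])
    · intro h d s hs
      refine h s fun y hy => ?_
      rw [List.mem_cons, not_or] at hy
      rw [hs y hy.2, Function.update_of_ne hy.1]

/-- The universal quantification of a schema that is interpreted by `b` is interpreted by the
intersection of all instances. -/
theorem mem_sem_alls {α : Type u} {W : Type} {B : Schema W α} {v : α → Var}
    {b : (W → Var) → Set M}
    (hB : ∀ n (t : W → Term α n) w, sem P I (B n t) v w = b fun x => Sum.elim v w (t x))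
    (ws : List W) (n : ℕ) (t : W → Term α n) (w : Fin n → Var) {m : M} (hm : ∀ s, m ∈ b s) :
    m ∈ sem P I (alls B ws n t) v w := by
  induction ws generalizing n with
  | nil => rw [alls, hB]; exact hm _
  | cons a ws ih => exact Set.mem_iInter.2 fun d => ih _ _ _

/-- A tensor product of formulae that are interpreted by single elements is interpreted by the sum
of these elements. -/
theorem sem_tensors_map {α : Type u} {n : ℕ} {v : α → Var} {w : Fin n → Var} {ι : Type*}
    {A : PreFormula α n} {a : M} (hA : sem P I A v w = phaseClosure P {a})
    {f : ι → PreFormula α n} {g : ι → M} (hf : ∀ i, sem P I (f i) v w = phaseClosure P {g i})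
    (l : List ι) :
    sem P I (tensors A (l.map f)) v w = phaseClosure P {(l.map g).sum + a} := by
  induction l with
  | nil => simpa [tensors] using hA
  | cons i l ih =>
    change phaseClosure P (sem P I (f i) v w + sem P I (tensors A (l.map f)) v w) = _
    rw [ih, hf, phaseClosure_add_singleton, List.map_cons, List.sum_cons, add_assoc]

theorem mem_sem_tensors {α : Type u} {n : ℕ} {v : α → Var} {w : Fin n → Var}
    {A : PreFormula α n} {m : M} (hA : m ∈ sem P I A v w) {l : List (PreFormula α n)}
    (hl : ∀ B ∈ l, 0 ∈ sem P I B v w) : m ∈ sem P I (tensors A l) v w := by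
  induction l with
  | nil => exact hA
  | cons B l ih =>
    exact subset_phaseClosure _ ⟨0, hl B List.mem_cons_self, m,
      ih fun C hC => hl C (List.mem_cons_of_mem B hC), zero_add m⟩

end Phase

/-! ### The phase space of configurations -/

section Space

variable {code : A.Symbol → ℕ} {Δ : Set A.Symbol}

/-- The interpretation of the atoms by configurations. The atoms for nodes and hyperedges are
interpreted by single nodes and hyperedges, and `token` is interpreted by the empty
configuration. The set `Δ` consists of the symbols that are used, on which `code` is meant to be
injective. -/
def interp (code : A.Symbol → ℕ) (Δ : Set A.Symbol) (p : PredSymbol) (args : Fin p.arity → Var) :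
    Set (Config A Var) :=
  {c | (p = ⟨0, 0⟩ ∧ c = 0) ∨
    (∃ d, (⟨p, args⟩ : Σ p : PredSymbol, (Fin p.arity → Var)) = ⟨⟨0, 1⟩, fun _ => d⟩ ∧
      c = ({d}, 0)) ∨
    ∃ l : Link A Var, l.1 ∈ Δ ∧
      (⟨p, args⟩ : Σ p : PredSymbol, (Fin p.arity → Var)) =
        ⟨⟨code l.1 + 1, Nat.card (A.type l.1)⟩, fun i => l.2 ((Finite.equivFin _).symm i)⟩ ∧
      c = (0, {l})}

variable {P : Set (Config A Var)} {α : Type w} {n : ℕ} (v : α → Var) (w : Fin n → Var)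

theorem sem_token : sem P (interp code Δ) token v w = phaseClosure P {0} := by
  simp only [token, sem]
  congr 1
  ext c
  simp [interp]

theorem sem_nodeAtom (x : Term α n) :
    sem P (interp code Δ) (nodeAtom x) v w = phaseClosure P {({Sum.elim v w x}, 0)} := by
  simp only [nodeAtom, sem]
  congr 1
  ext c
  constructor
  · rintro (⟨h, -⟩ | ⟨d, h, rfl⟩ | ⟨l, -, h, -⟩)
    · simp at h
    · have hd : Sum.elim v w x = d := congrFun (eq_of_heq (Sigma.mk.inj h).2) 0
      rw [hd]
      rfl
    · have := congrArg (fun q => q.1.index) h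
      simp at this
  · rintro rfl
    exact Or.inr (Or.inl ⟨_, rfl, rfl⟩)

theorem sem_linkAtom (hcode : Set.InjOn code Δ) {a : A.Symbol} (ha : a ∈ Δ)
    (t : A.type a → Term α n) :
    sem P (interp code Δ) (linkAtom code a t) v w =
      phaseClosure P {(0, {⟨a, fun σ => Sum.elim v w (t σ)⟩})} := by
  simp only [linkAtom, sem]
  congr 1
  ext c
  constructor
  · rintro (⟨h, -⟩ | ⟨d, h, -⟩ | ⟨⟨b, t'⟩, hb, h, rfl⟩)
    · simp at h
    · have := congrArg (fun q => q.1.index) h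
      simp at this
    · have hab := congrArg (fun q => q.1.index) h
      simp only [Nat.add_right_cancel_iff] at hab
      obtain rfl := hcode ha hb hab
      have := eq_of_heq (Sigma.mk.inj h).2
      have : (fun σ => Sum.elim v w (t σ)) = t' := by
        funext σ
        rw [← (Finite.equivFin (A.type a)).symm_apply_apply σ]
        exact congrFun this (Finite.equivFin _ σ)
      rw [this]
      rfl
  · rintro rfl
    exact Or.inr (Or.inr ⟨⟨a, fun σ => Sum.elim v w (t σ)⟩, ha, rfl, rfl⟩)

theorem sum_map_enum {ι : Type} [Finite ι] {M : Type*} [AddCommMonoid M] (f : ι → M) :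
    ((enum ι).map f).sum = (family f).sum := by
  rw [← coe_map_enum, Multiset.sum_coe]

theorem sum_family_nodes {ι : Type*} [Finite ι] (f : ι → Var) :
    (family (fun i => (({f i}, 0) : Config A Var))).sum = (family f, 0) := by
  rw [← map_family (fun x => (({x}, 0) : Config A Var)) f]
  generalize family f = m
  induction m using Multiset.induction_on with
  | empty => rfl
  | cons a m ih => rw [Multiset.map_cons, Multiset.sum_cons, ih]; rfl

theorem sum_family_links {ι : Type*} [Finite ι] (f : ι → Link A Var) :
    (family (fun i => ((0, {f i}) : Config A Var))).sum = (0, family f) := by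
  rw [← map_family (fun x => ((0, {x}) : Config A Var)) f]
  generalize family f = m
  induction m using Multiset.induction_on with
  | empty => rfl
  | cons a m ih => rw [Multiset.map_cons, Multiset.sum_cons, ih]; rfl

/-- The formula that describes a hypergraph is interpreted by its configuration. -/
theorem sem_diagram (hcode : Set.InjOn code Δ) {H : Hypergraph A} (hH : H.Over Δ)
    (t : H.V → Term α n) :
    sem P (interp code Δ) (diagram code H n t) v w =
      phaseClosure P {H.config fun x => Sum.elim v w (t x)} := by
  have h1 := sem_tensors_map (sem_token (P := P) (code := code) (Δ := Δ) v w)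
    (fun e => sem_linkAtom v w hcode (hH e) fun σ => t (H.att e σ)) (enum H.E)
  have h2 := sem_tensors_map h1 (fun x => sem_nodeAtom v w (t x)) (enum H.V)
  rw [sum_map_enum, sum_map_enum, sum_family_nodes, sum_family_links, add_zero] at h2
  rw [diagram, tensors, List.foldr_append]
  refine h2.trans ?_
  simp [Hypergraph.config]
  rfl

end Space

/-! ### Derivations of the system as derivations in MILL1 -/

theorem exists_fresh (ι : Type) [Finite ι] (B : Multiset ℕ) :
    ∃ i : ι → ℕ, Function.Injective i ∧ ∀ x, i x ∉ B := by
  -- Every element of `B` is at most the sum of `B`.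
  refine ⟨fun x => B.sum + 1 + Finite.equivFin ι x, fun x y h => ?_, fun x hx => ?_⟩
  · exact (Finite.equivFin ι).injective (Fin.ext (Nat.add_left_cancel h))
  · have := Multiset.le_sum_of_mem hx
    lia

variable {code : A.Symbol → ℕ}

/-- A derivation of `G` can be simulated, from its end to its beginning, by a derivation in MILL1
that uses one formula per step. -/
theorem HTSystem.DerivesIn.exists_derivable (code : A.Symbol → ℕ) {𝒢 : HTSystem A} {n : ℕ}
    {S G : Hypergraph A} (hS : S = 𝒢.S) (h : 𝒢.DerivesIn n S G) :
    ∃ (hX : 𝒢.S.type = G.type) (R : List 𝒢.P), R.length = n ∧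
      ∀ f : G.V → Var, Function.Injective f →
        Derivable (token ::ₘ (((R.map fun r => ruleFormula code r.1 : List (Formula Var)) :
            Multiset (Formula Var)) + atoms code (G.config f)))
          ((goalFormula code 𝒢.S).subst fun σ => f (G.ext ⟨σ.1, hX.subset σ.2⟩)) := by
  induction h with
  | @refl G H hi =>
    subst hS
    refine ⟨hi.1, [], rfl, fun f _ => ?_⟩
    obtain ⟨φ, hφ, hφe⟩ := hi.exists_equiv (D := Var)
    rw [← hφ f, List.map_nil, Multiset.coe_nil, zero_add]
    exact Derivable.goalFormula_right 𝒢.S_injective fun σ => congrArg f (hφe _ _ _)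
  | @step n S G G' r _ hr hstep ih =>
    obtain ⟨hX, R, hR, ih⟩ := ih hS
    refine ⟨hX.trans ?_, ⟨r, hr⟩ :: R, by simp [hR], fun f' hf' => ?_⟩
    · obtain ⟨K, e, h, h', -, hi, hi'⟩ := hstep
      exact hi.1.trans hi'.1.symm
    obtain ⟨i, hi, hif⟩ := exists_fresh r.lhs.V (0 ::ₘ family f')
    have hif' : ∀ v x, i v ≠ f' x := fun v x h =>
      hif v (Multiset.mem_cons_of_mem (mem_family.2 ⟨x, h.symm⟩))
    obtain ⟨ht, f, C, s, s', hf, hext, hG, hG', hs, hsi⟩ := hstep.exists_config hf' hi hif'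
    have hgoal : (fun σ : 𝒢.S.type => f (G.ext ⟨σ.1, hX.subset σ.2⟩)) =
        fun σ => f' (G'.ext ⟨σ.1, (hX.trans ht).subset σ.2⟩) := funext fun σ => hext _ _ _
    have hd := ih f hf
    rw [hgoal, hG, atoms_add] at hd
    rw [hG', atoms_add, List.map_cons, ← Multiset.cons_coe]
    have hperm : token ::ₘ (ruleFormula code r ::ₘ
        ((R.map fun r => ruleFormula code r.1 : List (Formula Var)) : Multiset (Formula Var)) +
          (atoms code C + atoms code (r.rhs.config s'))) =
        ruleFormula code r ::ₘ (token ::ₘ atoms code (r.rhs.config s') +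
          (((R.map fun r => ruleFormula code r.1 : List (Formula Var)) :
            Multiset (Formula Var)) + atoms code C)) := by
      simp only [← Multiset.singleton_add]
      abel
    rw [hperm]
    refine Derivable.ruleFormula_left hs ?_ ?_ ?_ ?_ ?_ ?_
    · intro v hv h0
      rw [hsi v hv] at h0
      exact hif v (by rw [h0]; exact Multiset.mem_cons_self 0 _)
    · intro v hv w hw h
      rw [hsi v hv, hsi w hw] at h
      exact hi h
    · intro v hv x
      have : s' x ∈ (G'.config f').1 := by
        rw [hG']
        exact Multiset.mem_add.2 (Or.inr (mem_family.2 ⟨x, rfl⟩))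
      obtain ⟨y, hy⟩ := mem_family.1 this
      rw [hsi v hv, ← hy]
      exact hif' v y
    · intro v hv E hE hfree
      rw [hsi v hv] at hfree
      rcases Multiset.mem_add.1 hE with hE | hE
      · obtain ⟨r', -, rfl⟩ := List.mem_map.1 (Multiset.mem_coe.1 hE)
        exact not_freeIn_ruleFormula _ _ _ hfree
      · obtain ⟨x, hx⟩ := exists_of_freeIn_atoms (H := G') (f := f')
          (hG'.symm ▸ ⟨Multiset.le_add_right _ _, Multiset.le_add_right _ _⟩ : C ≤ _) hE hfree
        exact hif' v x hx.symm
    · intro v hv hfree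
      rw [hsi v hv] at hfree
      obtain ⟨σ, hσ⟩ := exists_of_freeIn_goalFormula _ _ hfree
      exact hif' v _ hσ.symm
    · convert hd using 2
      abel

/-! ### The phase space of a system -/

section Soundness

variable (𝒢 : HTSystem A) (d₀ : 𝒢.S.type → Var)

/-- A configuration is reachable if it describes hypergraphs, with the external nodes `d₀`, and
the system derives all of these from its start hypergraph. -/
def Reachable (c : Config A Var) : Prop :=
  (∀ l ∈ c.2, ∀ σ, l.2 σ ∈ c.1) ∧ (∀ σ, d₀ σ ∈ c.1) ∧
    ∀ (G : Hypergraph A) (f : G.V → Var), Function.Injective f → G.config f = c →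
      G.type = 𝒢.S.type → (∀ σ h h', f (G.ext ⟨σ, h⟩) = d₀ ⟨σ, h'⟩) →
      ∃ n, 𝒢.DerivesIn n 𝒢.S G

/-- The configurations that are reachable unless they contain a repeated node. The exception
covers instances of universal quantifiers where one variable is used for two nodes. -/
def pole : Set (Config A Var) := {c | c.1.Nodup → Reachable 𝒢 d₀ c}

variable {𝒢 d₀}

/-- If all configurations that arise from `k` by adding a copy of the left-hand side of a rule
belong to the pole, then so do those that arise from `k` by adding the right-hand side: a copy of
the left-hand side whose internal nodes are new can be transformed. -/
theorem add_rhs_mem_pole {r : HTRule A} (hr : r ∈ 𝒢.P) {k : Config A Var} {s' : r.rhs.V → Var}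
    (h : ∀ s : r.lhs.V → Var,
      (∀ σ h h', s (r.lhs.ext ⟨σ, h⟩) = s' (r.rhs.ext ⟨σ, h'⟩)) →
        k + r.lhs.config s ∈ pole 𝒢 d₀) :
    k + r.rhs.config s' ∈ pole 𝒢 d₀ := by
  classical
  intro hnd
  change (k.1 + family s').Nodup at hnd
  obtain ⟨hk, hs', hdisj⟩ := Multiset.nodup_add.1 hnd
  have hd₀ : Finite 𝒢.S.type := Finite.of_injective _ 𝒢.S_injective
  obtain ⟨i, hi, hif⟩ := exists_fresh r.lhs.V
    (k.1 + k.2.bind (fun l => family l.2) + family d₀ + family s')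
  simp only [Multiset.mem_add, not_or, Multiset.mem_bind, not_exists, not_and, mem_family] at hif
  -- The external nodes of the copy of the left-hand side are those of the right-hand side, and its
  -- internal nodes are new.
  let s : r.lhs.V → Var := fun v => Sum.elim s' i (r.glue v)
  have hs : ∀ σ h h', s (r.lhs.ext ⟨σ, h⟩) = s' (r.rhs.ext ⟨σ, h'⟩) := fun σ h h' => by
    simp only [s, r.glue_ext σ h h', Sum.elim_inl]
  have hsi : ∀ v ∉ Set.range r.lhs.ext, s v = i v := fun v hv => by
    simp only [s, r.glue_of_notMem hv, Sum.elim_inr]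
  have hcase : ∀ v, (∃ x, s' x = s v) ∨ (v ∉ Set.range r.lhs.ext ∧ s v = i v) := by
    intro v
    by_cases hv : v ∈ Set.range r.lhs.ext
    · obtain ⟨⟨σ, hσ⟩, rfl⟩ := hv
      exact Or.inl ⟨_, (hs σ hσ (r.type_eq.subset hσ)).symm⟩
    · exact Or.inr ⟨hv, hsi v hv⟩
  have hsinj : Function.Injective s :=
    ((nodup_family.1 hs').sumElim hi fun x v h => (hif v).2 x h).comp r.glue_injective
  have hnd' : (k + r.lhs.config s).1.Nodup := by
    refine Multiset.nodup_add.2 ⟨hk, nodup_family.2 hsinj, Multiset.disjoint_left.2 ?_⟩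
    intro x hx hxs
    obtain ⟨v, rfl⟩ := mem_family.1 hxs
    rcases hcase v with ⟨y, hy⟩ | ⟨-, hv⟩
    · exact Multiset.disjoint_left.1 hdisj hx (mem_family.2 ⟨y, hy⟩)
    · rw [hv] at hx
      exact (hif v).1.1.1 hx
  obtain ⟨h1, h2, h3⟩ := h s hs hnd'
  have hmem : ∀ x ∈ (k + r.lhs.config s).1, (∀ v, x ≠ i v) → x ∈ (k + r.rhs.config s').1 := by
    intro x hx hxi
    rcases Multiset.mem_add.1 hx with hx | hx
    · exact Multiset.mem_add.2 (Or.inl hx)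
    · obtain ⟨v, rfl⟩ := mem_family.1 hx
      rcases hcase v with ⟨y, hy⟩ | ⟨-, hv⟩
      · exact Multiset.mem_add.2 (Or.inr (mem_family.2 ⟨y, hy⟩))
      · exact absurd hv (hxi v)
  refine ⟨?_, ?_, ?_⟩
  · intro l hl σ
    rcases Multiset.mem_add.1 hl with hl | hl
    · exact hmem _ (h1 l (Multiset.mem_add.2 (Or.inl hl)) σ) fun v hv =>
        (hif v).1.1.2 l hl σ hv
    · obtain ⟨e, rfl⟩ := mem_family.1 hl
      exact Multiset.mem_add.2 (Or.inr (mem_family.2 ⟨_, rfl⟩))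
  · exact fun σ => hmem _ (h2 σ) fun v hv => (hif v).1.2 σ hv
  · intro G' f' hf' hG' ht' hext'
    obtain ⟨G, f, hf, hG, ht, hext⟩ := exists_config_eq _ hnd' h1 𝒢.S.type d₀ h2
    obtain ⟨n, hn⟩ := h3 G f hf hG ht hext
    refine ⟨n + 1, hn.step hr (HTRule.Step.of_config hf hf' hG hG' hs (ht.trans ht'.symm) ?_ ?_)⟩
    · intro σ h h'
      rw [hext σ h (ht.subset h), hext' σ h' (ht.subset h)]
    · intro v hv
      rw [hsi v hv]
      exact ⟨fun l hl σ h => (hif v).1.1.2 l hl σ h,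
        fun σ h => (hif v).1.2 ⟨σ.1, ht.subset σ.2⟩ ((hext _ _ _).symm.trans h)⟩

/-- The formula of a rule is valid. -/
theorem zero_mem_sem_ruleFormula (hcode : Set.InjOn code (𝒢.N ∪ 𝒢.T)) {r : HTRule A} (hr : r ∈ 𝒢.P)
    {α : Type w} (v : α → Var) (w : Fin 0 → Var) :
    0 ∈ sem (pole 𝒢 d₀) (interp code (𝒢.N ∪ 𝒢.T)) (ruleFormula code r) v w := by
  have hl := fun n (t : r.rhs.V ⊕ r.lhs.V → Term α n) w =>
    sem_diagram (P := pole 𝒢 d₀) v w hcode (𝒢.lhs_over r hr) fun x => t (r.glue x)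
  refine Set.mem_iInter.2 fun d => mem_sem_alls (b := fun s => {m |
    ∀ x ∈ phaseClosure (pole 𝒢 d₀) {r.rhs.config fun x => s (.inl x)},
      m + x ∈ {m | ∀ k, (∀ s' : r.rhs.V ⊕ r.lhs.V → Var,
        (∀ y ∉ r.lhs.internal.map Sum.inr, s' y = s y) →
          ∀ x ∈ phaseClosure (pole 𝒢 d₀) {r.lhs.config fun x => s' (r.glue x)},
            k + x ∈ pole 𝒢 d₀) → k + m ∈ pole 𝒢 d₀}}) ?_ _ _ _ _ ?_
  · intro n t w
    have hlhs : sem (pole 𝒢 d₀) (interp code (𝒢.N ∪ 𝒢.T)) (lhsSchema code r n t) v w =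
        {m | ∀ k, (∀ s' : r.rhs.V ⊕ r.lhs.V → Var,
          (∀ y ∉ r.lhs.internal.map Sum.inr, s' y = Sum.elim v w (t y)) →
            ∀ x ∈ phaseClosure (pole 𝒢 d₀) {r.lhs.config fun x => s' (r.glue x)},
              k + x ∈ pole 𝒢 d₀) → k + m ∈ pole 𝒢 d₀} := by
      have := fun k => forall_mem_sem_exs hl (r.lhs.internal.map .inr) n t w k
        (b := fun s => phaseClosure (pole 𝒢 d₀) {r.lhs.config fun x => s (r.glue x)})
      ext m
      simp only [Set.mem_ofPred_eq, ← this]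
      exact ⟨fun hm k hk => hk m hm, fun hm => sem_closed _ _ _ hm⟩
    simp only [ruleSchema, sem, hlhs,
      sem_diagram (P := pole 𝒢 d₀) v w hcode (𝒢.rhs_over r hr) fun x => t (.inl x)]
  · intro s x hx k hk
    rw [zero_add]
    refine hx k fun y hy => ?_
    rw [Set.mem_singleton_iff.1 hy]
    refine add_rhs_mem_pole hr fun sl hsl => ?_
    classical
    -- The instance of the existential quantifiers that corresponds to the copy `sl`.
    let s' : r.rhs.V ⊕ r.lhs.V → Var := Sum.elim (fun x => s (.inl x)) fun v =>
      if v ∈ Set.range r.lhs.ext then s (.inr v) else sl v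
    have := hk s' ?_ _ (subset_phaseClosure _ rfl)
    · convert this using 3
      funext v
      by_cases hv : v ∈ Set.range r.lhs.ext
      · obtain ⟨⟨σ, hσ⟩, rfl⟩ := hv
        rw [r.glue_ext σ hσ (r.type_eq.subset hσ)]
        exact hsl _ _ _
      · rw [r.glue_of_notMem hv]
        exact (if_neg hv).symm
    · rintro (y | y) hy
      · rfl
      · by_cases hv : y ∈ Set.range r.lhs.ext
        · exact if_pos hv
        · exact absurd (List.mem_map.2 ⟨y, Hypergraph.mem_internal.2 hv, rfl⟩) hy

/-- The goal formula is interpreted by a subset of the pole. -/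
theorem sem_goalFormula_subset (hcode : Set.InjOn code (𝒢.N ∪ 𝒢.T)) (w : Fin 0 → Var) :
    sem (pole 𝒢 d₀) (interp code (𝒢.N ∪ 𝒢.T)) (goalFormula code 𝒢.S) d₀ w ⊆ pole 𝒢 d₀ := by
  have hS := fun n (t : 𝒢.S.V → Term 𝒢.S.type n) w =>
    sem_diagram (P := pole 𝒢 d₀) d₀ w hcode 𝒢.S_over t
  intro m hm
  -- Membership in the closure is applied to the empty context.
  rw [← zero_add m]
  refine hm 0 fun x hx => ?_
  obtain ⟨d, hx⟩ := Set.mem_iUnion.1 hx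
  refine (forall_mem_sem_exs (b := fun s => phaseClosure (pole 𝒢 d₀) {𝒢.S.config s})
    hS _ _ _ _ 0).2 ?_ x hx
  intro s hs
  rw [forall_mem_phaseClosure]
  intro y hy hnd
  rw [Set.mem_singleton_iff.1 hy, zero_add] at hnd ⊢
  have hsd : ∀ σ, s (𝒢.S.ext σ) = d₀ σ := by
    intro σ
    rw [hs _ fun h => Hypergraph.mem_internal.1 h ⟨σ, rfl⟩, goalTerm_ext 𝒢.S_injective]
    rfl
  refine ⟨?_, fun σ => mem_family.2 ⟨_, hsd σ⟩, ?_⟩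
  · intro l hl σ
    obtain ⟨e, rfl⟩ := mem_family.1 hl
    exact mem_family.2 ⟨_, rfl⟩
  · intro G f hf hG ht hext
    refine ⟨0, HTSystem.DerivesIn.refl (Iso.of_config hf hG.symm ht.symm ?_)⟩
    intro σ h h'
    rw [hsd, hext]

end Soundness

/-! ### The grammar of a system -/

section Grammar

variable (code : A.Symbol → ℕ) (𝒢 : HTSystem A) (c : ℕ)

/-- The tensor product of an atom and of the formulae of some rules. -/
noncomputable def withRules {α : Type w} (B : Formula α) (R : List 𝒢.P) : Formula α :=
  tensors B (R.map fun r => ruleFormula code r.1)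

theorem subst_withRules {α β : Type*} (h : α → β) (B : Formula α) (R : List 𝒢.P) :
    (withRules code 𝒢 B R).subst h = withRules code 𝒢 (B.subst h) R := by
  simp only [withRules, subst_tensors, List.map_map]
  congr 2
  funext r
  exact subst_ruleFormula code r.1 h

theorem finite_withRules {α : Type w} (B : Formula α) :
    {F | ∃ R : List 𝒢.P, R.length ≤ c ∧ F = withRules code 𝒢 B R}.Finite := by
  have : Finite 𝒢.P := 𝒢.finite_P
  refine ((List.finite_length_le 𝒢.P c).image (withRules code 𝒢 B)).subset ?_
  rintro _ ⟨R, hR, rfl⟩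
  exact ⟨R, hR, rfl⟩

/-- The grammar that generates the hypergraphs with derivations of at most `c` steps per node or
hyperedge: each node and each hyperedge contributes the formulae of at most `c` steps. -/
noncomputable def grammar : MILL1Grammar A where
  T := 𝒢.T
  finite_T := 𝒢.finite_T
  X := 𝒢.S.type
  S := .lolli token (goalFormula code 𝒢.S)
  edge a := {F | a ∈ 𝒢.T ∧
    ∃ R : List 𝒢.P, R.length ≤ c ∧ F = withRules code 𝒢 (linkAtom code a .inl) R}
  edge_subset := fun _ ⟨_, h⟩ => h.1
  finite_edge _ := (finite_withRules code 𝒢 c _).subset fun _ h => h.2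
  node := {F | ∃ R : List 𝒢.P, R.length ≤ c ∧ F = withRules code 𝒢 (nodeAtom (.inl ())) R}
  finite_node := finite_withRules code 𝒢 c _

open scoped Pointwise in
theorem sum_mem_sum_family {ι : Type*} [Finite ι] {M : Type*} [AddCommMonoid M] {s : ι → Set M}
    {m : ι → M} (h : ∀ i, m i ∈ s i) : (family m).sum ∈ (family s).sum :=
  Set.multiset_sum_mem_multiset_sum _ _ _ fun i _ => h i

variable {code 𝒢 c}

/-- As the formulae of the rules are valid, they do not affect the membership of `m`. -/
theorem mem_sem_withRules (hcode : Set.InjOn code (𝒢.N ∪ 𝒢.T)) {d₀ : 𝒢.S.type → Var} {α : Type w}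
    {v : α → Var} {B : Formula α} {m : Config A Var}
    (hm : m ∈ sem (pole 𝒢 d₀) (interp code (𝒢.N ∪ 𝒢.T)) B v Fin.elim0) (R : List 𝒢.P) :
    m ∈ sem (pole 𝒢 d₀) (interp code (𝒢.N ∪ 𝒢.T)) (withRules code 𝒢 B R) v Fin.elim0 := by
  refine mem_sem_tensors hm fun C hC => ?_
  obtain ⟨r, -, rfl⟩ := List.mem_map.1 hC
  exact zero_mem_sem_ruleFormula hcode r.2 v _

open scoped Pointwise in
/-- Soundness of the grammar: the configuration of `H` belongs to the interpretation of the
left-hand side of the sequent, and hence to the pole. -/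
theorem grammar_language_subset (hcode : Set.InjOn code (𝒢.N ∪ 𝒢.T)) :
    (grammar code 𝒢 c).language ⊆ 𝒢.language := by
  rintro H ⟨hT, hX, ι, hι, hV, hE, hVn, hEn, hd⟩
  refine ⟨hT, ?_⟩
  let d₀ : 𝒢.S.type → Var := fun σ => ι (H.ext ⟨σ.1, hX.subset σ.2⟩)
  have hsub := hd.sem_subset (P := pole 𝒢 d₀) (I := interp code (𝒢.N ∪ 𝒢.T)) id
  rw [Multiset.map_add, Multiset.sum_add, multisetOf_eq_family, multisetOf_eq_family, map_family,
    map_family] at hsub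
  simp only [sem_subst, id] at hsub
  have hlinks : ∀ e, ((0, {H.link ι e}) : Config A Var) ∈ sem (pole 𝒢 d₀)
      (interp code (𝒢.N ∪ 𝒢.T)) (hE e) (fun σ => ι (H.att e σ)) Fin.elim0 := by
    intro e
    obtain ⟨ha, R, -, hR⟩ := hEn e
    rw [hR]
    refine mem_sem_withRules hcode ?_ R
    rw [sem_linkAtom _ _ hcode (Or.inr ha)]
    exact subset_phaseClosure _ rfl
  have hnodes : ∀ x, (({ι x}, 0) : Config A Var) ∈ sem (pole 𝒢 d₀)
      (interp code (𝒢.N ∪ 𝒢.T)) (hV x) (fun _ => ι x) Fin.elim0 := by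
    intro x
    obtain ⟨R, -, hR⟩ := hVn x
    rw [hR]
    refine mem_sem_withRules hcode ?_ R
    rw [sem_nodeAtom]
    exact subset_phaseClosure _ rfl
  have hl := sum_mem_sum_family hlinks
  have hn := sum_mem_sum_family hnodes
  rw [sum_family_links] at hl
  rw [sum_family_nodes] at hn
  have h0 : (0 : Config A Var) ∈ sem (pole 𝒢 d₀) (interp code (𝒢.N ∪ 𝒢.T))
      (token : Formula 𝒢.S.type) d₀ Fin.elim0 := by
    rw [sem_token]
    exact subset_phaseClosure _ rfl
  have hgoal : (0, family (H.link ι)) + (family ι, 0) + 0 ∈ pole 𝒢 d₀ :=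
    sem_goalFormula_subset hcode _ (hsub ⟨_, hl, _, hn, rfl⟩ 0 h0)
  have hc : (0, family (H.link ι)) + (family ι, 0) + 0 = H.config ι := by
    rw [add_zero, Prod.mk_add_mk, zero_add, add_zero]
    rfl
  rw [hc] at hgoal
  exact (hgoal (nodup_family.2 hι)).2.2 H ι hι rfl hX.symm fun _ _ _ => rfl

/-- Completeness of the grammar: the formulae of the steps of a derivation are distributed over
the nodes and hyperedges of the derived hypergraph. -/
theorem subset_grammar_language
    (hc : ∀ H ∈ 𝒢.language, ∃ n, n ≤ c * H.size ∧ 𝒢.DerivesIn n 𝒢.S H) :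
    𝒢.language ⊆ (grammar code 𝒢 c).language := by
  intro H hH
  obtain ⟨n, hn, hd⟩ := hc H hH
  obtain ⟨hX, R, hR, hd⟩ := hd.exists_derivable code rfl
  obtain ⟨ι, hι, -⟩ := exists_fresh H.V 0
  obtain ⟨L, hL, hLR⟩ := exists_family_bind_eq (ι := H.E ⊕ H.V) c R (by
    rw [hR, Nat.card_sum, add_comm]
    exact hn)
  refine ⟨hH.1, hX, ι, hι, fun x => withRules code 𝒢 (nodeAtom (.inl ())) (L (.inr x)),
    fun e => withRules code 𝒢 (linkAtom code (H.lab e) .inl) (L (.inl e)),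
    fun x => ⟨_, hL _, rfl⟩, fun e => ⟨hH.1 e, _, hL _, rfl⟩, ?_⟩
  simp only [subst_withRules, multisetOf_eq_family]
  change Derivable _ (.lolli (token.subst fun σ : 𝒢.S.type => ι (H.ext ⟨σ.1, hX.subset σ.2⟩))
    ((goalFormula code 𝒢.S).subst fun σ => ι (H.ext ⟨σ.1, hX.subset σ.2⟩)))
  rw [subst_token]
  refine Derivable.lolliR ?_
  let p : H.E ⊕ H.V → Formula Var × List (Formula Var) := fun x =>
    (Sum.elim (fun e => linkAtom code (H.lab e) fun σ => .inl (ι (H.att e σ)))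
      (fun v => nodeAtom (.inl (ι v))) x, (L x).map fun r => ruleFormula code r.1)
  have hp := family_sum fun x => tensors (p x).1 (p x).2
  rw [← map_family (fun q : Formula Var × List (Formula Var) => tensors q.1 q.2) p] at hp
  have hfst : (family p).map Prod.fst = atoms code (H.config ι) := by
    rw [map_family, family_sum, add_comm, atoms, config, map_family, map_family]
    rfl
  have hsnd : ((family p).bind fun q => (q.2 : Multiset (Formula Var))) =
      ((R.map fun r => ruleFormula code r.1 : List (Formula Var)) : Multiset (Formula Var)) := by
    rw [← Multiset.map_coe, ← hLR, Multiset.map_bind]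
    simp only [Multiset.bind, map_family, Multiset.map_coe, p]
  have key := Derivable.map_tensors_left (I := family p) (Γ := {token}) (C :=
    (goalFormula code 𝒢.S).subst fun σ => ι (H.ext ⟨σ.1, hX.subset σ.2⟩)) (by
      rw [hfst, hsnd]
      convert hd ι hι using 1
      rw [← Multiset.singleton_add]
      abel)
  rw [hp, add_comm, Multiset.singleton_add] at key
  exact key

end Grammar

end HG

theorem mainTheorem3 {Sel : Type*} (A : HG.TypedAlphabet Sel) (𝒢 : HG.HTSystem A)
    (h𝒢 : 𝒢.LinearTime) :
    ∃ 𝒢' : HG.MILL1Grammar A, 𝒢'.T = 𝒢.T ∧ 𝒢'.language = 𝒢.language := by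
  obtain ⟨c, hc⟩ := h𝒢
  obtain ⟨code, hcode⟩ := Set.countable_iff_exists_injOn.1 (𝒢.finite_N.union 𝒢.finite_T).countable
  exact ⟨HG.grammar code 𝒢 c, rfl,
    (HG.grammar_language_subset hcode).antisymm (HG.subset_grammar_language hc)⟩
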